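/- **Setting.** Let $G$ be a group with a left-invariant metric, written additively, and let $A$ be a finite discrete alphabet with a symbol $0$. A subshift is a closed, shift-invariant subset of $A^{G}$. For $x\in A^{G}$ and $r\ge 0$, consider the graph on the nonzero cells of $x$ in which two distinct cells are joined when their distance is at most $r$. An $r$-connected component configuration of $x$ is obtained by turning to $0$ all cells outside one connected component of this graph. A subshift $X$ is $r$-zero-gluing if, for all $x\in A^G$, one has $x\in X$ if and only if every $r$-connected component configuration of $x$ is in $X$. The $r$-zero-gluing closure of $X$ is the intersection of all $r$-zero-gluing subshifts containing $X$. Below $G=\mathbb Z^3$ with the $\ell_\infty$ metric and $r=1$. **The substitution.** A tile has a slope in $\{0,+,-\}$ (the surface piece on it is flat, ascends by $1$, or descends by $1$ when moving north), and each of its west and east edges is either jagged or not; this gives $12$ tiles. Fix $a,b,c,d\in\mathbb N$ and put $e=2(a+b+c)+d$. The substitution $\tau$ maps a tile to a $5\times e$ rectangle of tiles (5 from west to east, $e$ from south to north). The image of a tile of slope $s$ without jagged edges consists, from south to north, of - $a$ rows with slopes $(s,s,s,s,s)$, - $b$ rows with slopes $(0,+,-,+,0)$, - $c$ rows with slopes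 $(0,+,0,+,0)$, - $d$ rows with slopes $(0,0,0,0,0)$, - $c$ rows with slopes $(0,-,0,-,0)$, - $b$ rows with slopes $(0,-,+,-,0)$, - $a$ rows with slopes $(s,s,s,s,s)$. In the first and last $a$ rows no edge is jagged; in all other rows the four west-east interior edges are jagged (on both tiles that share them) and the two outer edges are not. If the tile has a jagged west (east) edge, then in addition the west (east) edges of all tiles in the westmost (eastmost) column of the image are jagged. **The limit configuration.** Let $t$ be the flat tile without jagged edges. Gluing the surface pieces of $\tau^n(t)$ along all south-north adjacencies and along the non-jagged west-east adjacencies gives a surface, unique up to vertical translation. Let $\Delta$ consist of a blank cube, which is the zero symbol $0$, and three cubes containing a flat piece (on the bottom face), an ascending piece and a descending piece (each joining opposite edges of the cube). Replacing each surface piece by the corresponding cube gives a finite-support configuration $x^n\in\Delta^{\mathbb Z^3}$, translated so that the cube of the central tile, with coordinates $(\lfloor 5^n/2\rfloor,\lfloor e^n/2\rfloor)$ counted from the southwest tile $(0,0)$, is at the origin. **Theorem.** Suppose that $a>0$, $$\frac{b+c}{2a-1}+1+6a<\min\left(\frac b7,\frac c8\right)\qquad\text{and}\qquad d\ge 4(a+b+c).$$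 Then the sequence $(x^n)$ converges to a configuration $x\in\Delta^{\mathbb Z^3}$. Let $Z\subset\Delta^{\mathbb Z^3}$ be the $1$-zero-gluing closure of the orbit closure of $x$. Then $Z$ is a $1$-zero-gluing subshift, and its $\mathbb Z$-projective subdynamics $\{(z_{(0,0,k)})_{k\in\mathbb Z} : z\in Z\}$ is $2$-sparse: each of its elements has at most two nonzero symbols. Equivalently, no vertical column of a configuration in $Z$ contains three nonzero cells. -/

import Mathlib

open Filter Topology

namespace SparseSubshift

/-! ## Symbolic dynamics over a metric group -/

section Dynamics

variable {G A : Type*} [AddGroup G]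

/-- The left shift action of a group on configurations: `(g x)_h = x_{g⁻¹ h}`. -/
def shift (g : G) (x : G → A) : G → A := fun h => x (-g + h)

/-- A subshift: a topologically closed and shift-invariant set of configurations. The product
topology on `G → A` is used, with `A` discrete. -/
def IsSubshift [TopologicalSpace A] (X : Set (G → A)) : Prop :=
  IsClosed X ∧ ∀ g : G, ∀ x ∈ X, shift g x ∈ X

/-- The closure of the orbit of a configuration under all shifts. -/
def orbitClosure [TopologicalSpace A] (x : G → A) : Set (G → A) :=
  closure (Set.range fun g : G => shift g x)

/-- The graph on the nonzero cells of `x` in which two distinct cells are adjacent when their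
distance is at most `r` (cells with value zero are isolated vertices). -/
def sightGraph [PseudoMetricSpace G] [Zero A] (r : ℝ) (x : G → A) : SimpleGraph G where
  Adj u v := u ≠ v ∧ x u ≠ 0 ∧ x v ≠ 0 ∧ dist u v ≤ r
  symm := ⟨fun u v h => ⟨h.1.symm, h.2.2.1, h.2.1, dist_comm u v ▸ h.2.2.2⟩⟩
  loopless := ⟨fun _ h => h.1 rfl⟩

open Classical in
/-- The configuration obtained from `x` by turning to zero every cell outside the
`r`-connected component of the cell `u`. -/
noncomputable def componentConfig [PseudoMetricSpace G] [Zero A] (r : ℝ) (x : G → A) (u : G) :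
    G → A :=
  fun v => if (sightGraph r x).Reachable u v then x v else 0

/-- The set `C_r(x)` of `r`-connected component configurations of `x`. -/
def componentConfigs [PseudoMetricSpace G] [Zero A] (r : ℝ) (x : G → A) : Set (G → A) :=
  {z | ∃ u : G, x u ≠ 0 ∧ z = componentConfig r x u}

/-- A subshift is `r`-zero-gluing if membership of a configuration is equivalent to membership
of all its `r`-connected component configurations. -/
def IsZeroGluing [PseudoMetricSpace G] [Zero A] [TopologicalSpace A] (r : ℝ)
    (X : Set (G → A)) : Prop :=
  IsSubshift X ∧ ∀ x : G → A, x ∈ X ↔ ∀ z ∈ componentConfigs r x, z ∈ X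

/-- The intersection of all `r`-zero-gluing subshifts that contain `X`. -/
def zeroGluingClosure [PseudoMetricSpace G] [Zero A] [TopologicalSpace A] (r : ℝ)
    (X : Set (G → A)) : Set (G → A) :=
  ⋂₀ {Y | IsZeroGluing r Y ∧ X ⊆ Y}

/-- A set of configurations is `k`-sparse if each of them has at most `k` nonzero cells. -/
def IsSparse [Zero A] (k : ℕ) (X : Set (G → A)) : Prop :=
  ∀ x ∈ X, (Function.support x).encard ≤ k

/-- The `ℤ`-projective subdynamics of a set of `ℤ³`-configurations: restrictions to the vertical
axis `{0}² × ℤ`. -/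
def verticalTrace (X : Set (ℤ × ℤ × ℤ → A)) : Set (ℤ → A) :=
  (fun x k => x (0, 0, k)) '' X

end Dynamics

/-! ## The two-dimensional substitution

The first coordinate increases towards the east and the second one towards the north. -/

/-- The slant of a unit piece of surface: `up` ascends by one when moving north, `down` descends
by one when moving north. -/
inductive Slope where
  | flat
  | up
  | down

/-- The change of height when a piece of surface is crossed from its south to its north edge. -/
def Slope.rise : Slope → ℤ
  | .flat => 0
  | .up => 1
  | .down => -1

/-- The 12 tiles: a slant, and for each of the west and east edges whether it is jagged. -/
@[ext]
structure Tile where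
  slope : Slope
  jagW : Bool
  jagE : Bool

/-- A row of the image of a tile without jagged edges, close to its south or north border. -/
def plainRow (s : Slope) : ℕ → Tile := fun _ => ⟨s, false, false⟩

/-- A row of five tiles crossing the bridges: the two outermost tiles are flat, the two side
bridges have slant `s`, and the central bridge has slant `t`. All four interior edges are jagged. -/
def bridgeRow (s t : Slope) : ℕ → Tile
  | 0 => ⟨.flat, false, true⟩
  | 1 => ⟨s, true, true⟩
  | 2 => ⟨t, true, true⟩
  | 3 => ⟨s, true, true⟩
  | _ => ⟨.flat, true, false⟩

/-- The image, of shape `5 × (2(a+b+c)+d)`, of the tile of slant `s` without jagged edges. The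
entry `(i, j)` belongs to column `i` from the west and row `j` from the south. -/
def plainImage (a b c d : ℕ) (s : Slope) (i j : ℕ) : Tile :=
  if j < a then plainRow s i
  else if j < a + b then bridgeRow .up .down i
  else if j < a + b + c then bridgeRow .up .flat i
  else if j < a + b + c + d then bridgeRow .flat .flat i
  else if j < a + b + c + d + c then bridgeRow .down .flat i
  else if j < a + b + c + d + c + b then bridgeRow .down .up i
  else plainRow s i

/-- The substitution: a jagged west (east) edge of the tile makes the west (east) edges of the
westmost (eastmost) column of the image jagged. -/
def tau (a b c d : ℕ) (t : Tile) (i j : ℕ) : Tile where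
  slope := (plainImage a b c d t.slope i j).slope
  jagW := (plainImage a b c d t.slope i j).jagW || (decide (i = 0) && t.jagW)
  jagE := (plainImage a b c d t.slope i j).jagE || (decide (i = 4) && t.jagE)

/-- The south-north length of the substitution. -/
def len (a b c d : ℕ) : ℕ := 2 * (a + b + c) + d

/-- The iterated substitution `τ^n` applied to a tile. Only the entries `(i, j)` with `i < 5 ^ n`
and `j < len a b c d ^ n` are meaningful. -/
def macrotile (a b c d : ℕ) : ℕ → Tile → ℕ → ℕ → Tile
  | 0, t, _, _ => t
  | n + 1, t, i, j =>
    tau a b c d (macrotile a b c d n t (i / 5) (j / len a b c d)) (i % 5) (j % len a b c d)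

/-! ## Surfaces -/

/-- `f i j` is the height of the south edge of the tile at `(i, j)` in an interpretation of the
`w × l` rectangle `R` of tiles as a surface: pieces are glued along all south-north adjacencies,
and along those west-east adjacencies where the common edge is not jagged. -/
def IsSurface (R : ℕ → ℕ → Tile) (w l : ℕ) (f : ℕ → ℕ → ℤ) : Prop :=
  (∀ i j, i < w → j + 1 < l → f i (j + 1) = f i j + (R i j).slope.rise) ∧
  (∀ i j, i + 1 < w → j < l → (R i j).jagE = false → (R (i + 1) j).jagW = false →
    f (i + 1) j = f i j ∧ (R (i + 1) j).slope = (R i j).slope)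

/-- The heights of the south edges of the tiles of `τ^n(t)`, with its south border at height
zero. That this is the surface of `τ^n(t)`, and the only one up to a vertical translation, is
`isSurface_height` and `isSurface_unique`. -/
def height (a b c d n : ℕ) (t : Tile) (i j : ℕ) : ℤ :=
  ∑ m ∈ Finset.range j, (macrotile a b c d n t i m).slope.rise

theorem sum_plainImage (a b c d : ℕ) (s : Slope) (i r : ℕ) :
    ∑ m ∈ Finset.range r, (plainImage a b c d s i m).slope.rise =
      s.rise * ((min r a + (r - (a + b + c + d + c + b)) : ℕ) : ℤ) +
      match i with
      | 0 => 0
      | 1 | 3 => ((min (r - a) b + min (r - (a + b)) c : ℕ) : ℤ) -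
          ((min (r - (a + b + c + d)) c + min (r - (a + b + c + d + c)) b : ℕ) : ℤ)
      | 2 => ((min (r - (a + b + c + d + c)) b : ℕ) : ℤ) - ((min (r - a) b : ℕ) : ℤ)
      | _ => 0 := by
  induction r with
  | zero => rcases i with _ | _ | _ | _ | i <;> simp
  | succ r ih =>
    rw [Finset.sum_range_succ, ih]
    have hb : r < a ∨ (a ≤ r ∧ r < a + b) ∨ (a + b ≤ r ∧ r < a + b + c) ∨
        (a + b + c ≤ r ∧ r < a + b + c + d) ∨
        (a + b + c + d ≤ r ∧ r < a + b + c + d + c) ∨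
        (a + b + c + d + c ≤ r ∧ r < a + b + c + d + c + b) ∨
        a + b + c + d + c + b ≤ r := by omega
    rcases hb with h | h | h | h | h | h | h
    · have hp : plainImage a b c d s i r = plainRow s i := by
        unfold plainImage; split_ifs <;> first | rfl | omega
      have h0 : min (r + 1) a = (min (r) a) + 1 := by omega
      have h1 : min (r + 1 - a) b = min (r - a) b := by omega
      have h2 : min (r + 1 - (a + b)) c = min (r - (a + b)) c := by omega
      have h3 : min (r + 1 - (a + b + c + d)) c = min (r - (a + b + c + d)) c := by omega
      have h4 : min (r + 1 - (a + b + c + d + c)) b = min (r - (a + b + c + d + c)) b := by omega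
      have h5 : r + 1 - (a + b + c + d + c + b) = r - (a + b + c + d + c + b) := by omega
      rw [hp, h0, h1, h2, h3, h4, h5]
      rcases i with _ | _ | _ | _ | i <;>
        simp only [plainRow, Nat.cast_add, Nat.cast_one] <;> ring
    · have hp : plainImage a b c d s i r = bridgeRow .up .down i := by
        unfold plainImage; split_ifs <;> first | rfl | omega
      have h0 : min (r + 1) a = min r a := by omega
      have h1 : min (r + 1 - a) b = (min (r - a) b) + 1 := by omega
      have h2 : min (r + 1 - (a + b)) c = min (r - (a + b)) c := by omega
      have h3 : min (r + 1 - (a + b + c + d)) c = min (r - (a + b + c + d)) c := by omega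
      have h4 : min (r + 1 - (a + b + c + d + c)) b = min (r - (a + b + c + d + c)) b := by omega
      have h5 : r + 1 - (a + b + c + d + c + b) = r - (a + b + c + d + c + b) := by omega
      rw [hp, h0, h1, h2, h3, h4, h5]
      rcases i with _ | _ | _ | _ | i <;>
        simp only [bridgeRow, Slope.rise, Nat.cast_add, Nat.cast_one] <;> ring
    · have hp : plainImage a b c d s i r = bridgeRow .up .flat i := by
        unfold plainImage; split_ifs <;> first | rfl | omega
      have h0 : min (r + 1) a = min r a := by omega
      have h1 : min (r + 1 - a) b = min (r - a) b := by omega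
      have h2 : min (r + 1 - (a + b)) c = (min (r - (a + b)) c) + 1 := by omega
      have h3 : min (r + 1 - (a + b + c + d)) c = min (r - (a + b + c + d)) c := by omega
      have h4 : min (r + 1 - (a + b + c + d + c)) b = min (r - (a + b + c + d + c)) b := by omega
      have h5 : r + 1 - (a + b + c + d + c + b) = r - (a + b + c + d + c + b) := by omega
      rw [hp, h0, h1, h2, h3, h4, h5]
      rcases i with _ | _ | _ | _ | i <;>
        simp only [bridgeRow, Slope.rise, Nat.cast_add, Nat.cast_one] <;> ring
    · have hp : plainImage a b c d s i r = bridgeRow .flat .flat i := by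
        unfold plainImage; split_ifs <;> first | rfl | omega
      have h0 : min (r + 1) a = min r a := by omega
      have h1 : min (r + 1 - a) b = min (r - a) b := by omega
      have h2 : min (r + 1 - (a + b)) c = min (r - (a + b)) c := by omega
      have h3 : min (r + 1 - (a + b + c + d)) c = min (r - (a + b + c + d)) c := by omega
      have h4 : min (r + 1 - (a + b + c + d + c)) b = min (r - (a + b + c + d + c)) b := by omega
      have h5 : r + 1 - (a + b + c + d + c + b) = r - (a + b + c + d + c + b) := by omega
      rw [hp, h0, h1, h2, h3, h4, h5]
      rcases i with _ | _ | _ | _ | i <;>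
        simp only [bridgeRow, Slope.rise, Nat.cast_add] <;> ring
    · have hp : plainImage a b c d s i r = bridgeRow .down .flat i := by
        unfold plainImage; split_ifs <;> first | rfl | omega
      have h0 : min (r + 1) a = min r a := by omega
      have h1 : min (r + 1 - a) b = min (r - a) b := by omega
      have h2 : min (r + 1 - (a + b)) c = min (r - (a + b)) c := by omega
      have h3 : min (r + 1 - (a + b + c + d)) c = (min (r - (a + b + c + d)) c) + 1 := by omega
      have h4 : min (r + 1 - (a + b + c + d + c)) b = min (r - (a + b + c + d + c)) b := by omega
      have h5 : r + 1 - (a + b + c + d + c + b) = r - (a + b + c + d + c + b) := by omega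
      rw [hp, h0, h1, h2, h3, h4, h5]
      rcases i with _ | _ | _ | _ | i <;>
        simp only [bridgeRow, Slope.rise, Nat.cast_add, Nat.cast_one] <;> ring
    · have hp : plainImage a b c d s i r = bridgeRow .down .up i := by
        unfold plainImage; split_ifs <;> first | rfl | omega
      have h0 : min (r + 1) a = min r a := by omega
      have h1 : min (r + 1 - a) b = min (r - a) b := by omega
      have h2 : min (r + 1 - (a + b)) c = min (r - (a + b)) c := by omega
      have h3 : min (r + 1 - (a + b + c + d)) c = min (r - (a + b + c + d)) c := by omega
      have h4 : min (r + 1 - (a + b + c + d + c)) b = (min (r - (a + b + c + d + c)) b) + 1 := by omega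
      have h5 : r + 1 - (a + b + c + d + c + b) = r - (a + b + c + d + c + b) := by omega
      rw [hp, h0, h1, h2, h3, h4, h5]
      rcases i with _ | _ | _ | _ | i <;>
        simp only [bridgeRow, Slope.rise, Nat.cast_add, Nat.cast_one] <;> ring
    · have hp : plainImage a b c d s i r = plainRow s i := by
        unfold plainImage; split_ifs <;> first | rfl | omega
      have h0 : min (r + 1) a = min r a := by omega
      have h1 : min (r + 1 - a) b = min (r - a) b := by omega
      have h2 : min (r + 1 - (a + b)) c = min (r - (a + b)) c := by omega
      have h3 : min (r + 1 - (a + b + c + d)) c = min (r - (a + b + c + d)) c := by omega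
      have h4 : min (r + 1 - (a + b + c + d + c)) b = min (r - (a + b + c + d + c)) b := by omega
      have h5 : r + 1 - (a + b + c + d + c + b) = (r - (a + b + c + d + c + b)) + 1 := by omega
      rw [hp, h0, h1, h2, h3, h4, h5]
      rcases i with _ | _ | _ | _ | i <;>
        simp only [plainRow, Nat.cast_add, Nat.cast_one] <;> ring

/-- Outside the bridges all columns of a plain image have the same height. -/
theorem sum_plainImage_outer (a b c d : ℕ) (s : Slope) (i r : ℕ)
    (hr : r ≤ a ∨ a + b + c + d + c + b ≤ r) :
    ∑ m ∈ Finset.range r, (plainImage a b c d s i m).slope.rise =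
      s.rise * ((min r a + (r - (a + b + c + d + c + b)) : ℕ) : ℤ) := by
  rw [sum_plainImage]
  rcases hr with hr | hr
  · have h1 : min (r - a) b = 0 := by omega
    have h2 : min (r - (a + b)) c = 0 := by omega
    have h3 : min (r - (a + b + c + d)) c = 0 := by omega
    have h4 : min (r - (a + b + c + d + c)) b = 0 := by omega
    rw [h1, h2, h3, h4]
    rcases i with _ | _ | _ | _ | i <;> simp
  · have h1 : min (r - a) b = b := by omega
    have h2 : min (r - (a + b)) c = c := by omega
    have h3 : min (r - (a + b + c + d)) c = c := by omega
    have h4 : min (r - (a + b + c + d + c)) b = b := by omega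
    rw [h1, h2, h3, h4]
    rcases i with _ | _ | _ | _ | i <;> simp <;> ring

theorem sum_tau (a b c d : ℕ) (t : Tile) (i : ℕ) :
    ∑ m ∈ Finset.range (len a b c d), (tau a b c d t i m).slope.rise = t.slope.rise * (2 * a) := by
  simp only [tau]
  rw [sum_plainImage_outer _ _ _ _ _ _ _ (Or.inr (by unfold len; omega))]
  congr 1
  have h1 : min (len a b c d) a = a := by unfold len; omega
  have h2 : len a b c d - (a + b + c + d + c + b) = a := by unfold len; omega
  rw [h1, h2]
  push_cast
  ring

theorem height_succ (a b c d n : ℕ) (t : Tile) (i q r : ℕ) (hr : r < len a b c d) :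
    height a b c d (n + 1) t i (len a b c d * q + r) =
      height a b c d n t (i / 5) q * (2 * a) +
        ∑ m ∈ Finset.range r,
          (plainImage a b c d (macrotile a b c d n t (i / 5) q).slope (i % 5) m).slope.rise := by
  have key : ∀ q r, r ≤ len a b c d → height a b c d (n + 1) t i (len a b c d * q + r) =
      height a b c d (n + 1) t i (len a b c d * q) + ∑ m ∈ Finset.range r,
          (plainImage a b c d (macrotile a b c d n t (i / 5) q).slope (i % 5) m).slope.rise := by
    intro q r hr
    unfold height
    rw [Finset.sum_range_add]
    congr 1
    apply Finset.sum_congr rfl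
    intro m hm
    have hm' : m < len a b c d := lt_of_lt_of_le (Finset.mem_range.1 hm) hr
    have h1 : (len a b c d * q + m) / len a b c d = q := by
      rw [Nat.mul_add_div (by omega), Nat.div_eq_of_lt hm', add_zero]
    have h2 : (len a b c d * q + m) % len a b c d = m := by
      rw [Nat.mul_add_mod, Nat.mod_eq_of_lt hm']
    simp only [macrotile, tau, h1, h2]
  rw [key q r hr.le]
  congr 1
  induction q with
  | zero => simp [height]
  | succ q ih =>
    rw [mul_add, mul_one, key q _ le_rfl, ih]
    have := sum_tau a b c d (macrotile a b c d n t (i / 5) q) (i % 5)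
    simp only [tau] at this
    rw [this]
    unfold height
    rw [Finset.sum_range_succ]
    ring

/-- `height` interprets `τ^n(t)` as a surface. -/
theorem isSurface_height (a b c d n : ℕ) (t : Tile) :
    IsSurface (macrotile a b c d n t) (5 ^ n) (len a b c d ^ n) (height a b c d n t) := by
  refine ⟨fun i j _ _ => by unfold height; rw [Finset.sum_range_succ], ?_⟩
  induction n with
  | zero => intro i j hi; simp at hi
  | succ n ih =>
    intro i j hi hj hE hW
    have hL : 0 < len a b c d := by
      rcases Nat.eq_zero_or_pos (len a b c d) with h | h
      · rw [h] at hj; simp at hj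
      · exact h
    obtain ⟨q, r, hr, rfl⟩ : ∃ q r, r < len a b c d ∧ j = len a b c d * q + r :=
      ⟨j / len a b c d, j % len a b c d, Nat.mod_lt _ hL, (Nat.div_add_mod _ _).symm⟩
    have hq : q < len a b c d ^ n := by
      rw [pow_succ, mul_comm (len a b c d ^ n)] at hj
      exact Nat.lt_of_mul_lt_mul_left (lt_of_le_of_lt (Nat.le_add_right _ _) hj)
    have h1 : (len a b c d * q + r) / len a b c d = q := by
      rw [Nat.mul_add_div hL, Nat.div_eq_of_lt hr, add_zero]
    have h2 : (len a b c d * q + r) % len a b c d = r := by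
      rw [Nat.mul_add_mod, Nat.mod_eq_of_lt hr]
    have hlen : len a b c d = 2 * (a + b + c) + d := rfl
    rw [height_succ _ _ _ _ _ _ _ _ _ hr, height_succ _ _ _ _ _ _ _ _ _ hr]
    simp only [macrotile, h1, h2] at hE hW ⊢
    rw [pow_succ] at hi
    have hi5 : i % 5 < 5 := Nat.mod_lt _ (by norm_num)
    by_cases h4 : i % 5 = 4
    · have e1 : (i + 1) / 5 = i / 5 + 1 := by omega
      have e2 : (i + 1) % 5 = 0 := by omega
      rw [e1, e2] at hW ⊢
      rw [h4] at hE ⊢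
      simp only [tau, decide_true, Bool.true_and, Bool.or_eq_false_iff] at hE hW
      obtain ⟨hh, hs⟩ := ih (i / 5) q (by omega) hq hE.2 hW.2
      rw [hh, hs]
      refine ⟨by rw [sum_plainImage, sum_plainImage]; rfl, ?_⟩
      simp only [tau, hs, plainImage]
      split_ifs <;> rfl
    · have e1 : (i + 1) / 5 = i / 5 := by omega
      have e2 : (i + 1) % 5 = i % 5 + 1 := by omega
      rw [e1, e2] at hW ⊢
      generalize macrotile a b c d n t (i / 5) q = s at hE hW ⊢
      generalize i % 5 = k at *
      have hrow : r < a ∨ a + b + c + d + c + b ≤ r := by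
        by_contra hcon
        simp only [tau, Bool.or_eq_false_iff] at hE
        have := hE.1
        unfold plainImage at this
        interval_cases k <;> split_ifs at this <;> first | omega | simp [bridgeRow] at this
      refine ⟨?_, ?_⟩
      · have hrow2 : r ≤ a ∨ a + b + c + d + c + b ≤ r := hrow.imp_left le_of_lt
        rw [sum_plainImage_outer _ _ _ _ _ _ _ hrow2, sum_plainImage_outer _ _ _ _ _ _ _ hrow2]
      · have hrow' : ∀ i, plainImage a b c d s.slope i r = plainRow s.slope i := by
          intro i
          unfold plainImage
          split_ifs <;> first | rfl | omega
        simp only [tau, hrow', plainRow]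

/-- For `a > 0`, the southmost row of `τ^n(t)` has no jagged edge between adjacent tiles. -/
theorem macrotile_south (a b c d n : ℕ) (ha : 0 < a) (t : Tile) (i : ℕ) (hi : i + 1 < 5 ^ n) :
    (macrotile a b c d n t i 0).jagE = false ∧ (macrotile a b c d n t (i + 1) 0).jagW = false := by
  induction n generalizing i with
  | zero => simp at hi
  | succ n ih =>
    rw [pow_succ] at hi
    simp only [macrotile, Nat.zero_div, Nat.zero_mod, tau, plainImage, ha, if_true, plainRow,
      Bool.false_or]
    by_cases h4 : i % 5 = 4
    · have e1 : (i + 1) / 5 = i / 5 + 1 := by omega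
      have := ih (i / 5) (by omega)
      simp [e1, this]
    · have e2 : (i + 1) % 5 ≠ 0 := by omega
      simp [h4, e2]

/-- For `a > 0`, the surface of `τ^n(t)` is unique up to a vertical translation. -/
theorem isSurface_unique (a b c d n : ℕ) (ha : 0 < a) (t : Tile) (f : ℕ → ℕ → ℤ)
    (hf : IsSurface (macrotile a b c d n t) (5 ^ n) (len a b c d ^ n) f) (i j : ℕ)
    (hi : i < 5 ^ n) (hj : j < len a b c d ^ n) :
    f i j = f 0 0 + height a b c d n t i j := by
  induction j with
  | zero =>
    induction i with
    | zero => simp [height]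
    | succ i ih =>
      obtain ⟨h1, h2⟩ := macrotile_south a b c d n ha t i hi
      rw [(hf.2 i 0 hi hj h1 h2).1, ih (by omega)]
      simp [height]
  | succ j ih =>
    rw [hf.1 i j hi hj, ih (by omega)]
    unfold height
    rw [Finset.sum_range_succ]
    ring

/-! ## The three-dimensional configurations -/

/-- The alphabet of size 4: the blank cube, and cubes that contain a piece of surface. A flat piece
lies on the bottom face of its cube; a sloped piece joins a bottom edge to the opposite top edge. -/
inductive Cube where
  | blank
  | flat
  | up
  | down

instance : Zero Cube := ⟨Cube.blank⟩

instance : TopologicalSpace Cube := ⊥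

instance : DiscreteTopology Cube := ⟨rfl⟩

/-- The cube that represents a tile. Jagged edges are forgotten. -/
def cubeOf (t : Tile) : Cube :=
  match t.slope with
  | .flat => .flat
  | .up => .up
  | .down => .down

/-- The flat tile without jagged edges. -/
def flatTile : Tile := ⟨.flat, false, false⟩

/-- The vertical coordinate of the cube that contains the piece of the surface of `τ^n(t)` at
`(i, j)`, that is, of the lower one of its south and north edges. -/
def cubeHeight (a b c d n : ℕ) (t : Tile) (i j : ℕ) : ℤ :=
  min (height a b c d n t i j)
    (height a b c d n t i j + (macrotile a b c d n t i j).slope.rise)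

/-- The finite-support configuration `x^n` representing the surface of `τ^n` of the flat tile
without jagged edges, translated so that the cube of its central tile is at the origin. The central
tile is `(⌊5^n / 2⌋, ⌊len^n / 2⌋)`; for even length it is the northern one of the two central
tiles. -/
def surfaceConfig (a b c d n : ℕ) : ℤ × ℤ × ℤ → Cube := fun v =>
  let i₀ : ℕ := 5 ^ n / 2
  let j₀ : ℕ := len a b c d ^ n / 2
  let i : ℤ := v.1 + i₀
  let j : ℤ := v.2.1 + j₀
  if 0 ≤ i ∧ i < 5 ^ n ∧ 0 ≤ j ∧ j < (len a b c d : ℤ) ^ n ∧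
      v.2.2 = cubeHeight a b c d n flatTile i.toNat j.toNat -
        cubeHeight a b c d n flatTile i₀ j₀ then
    cubeOf (macrotile a b c d n flatTile i.toNat j.toNat)
  else 0

/-- The limit surface configuration `x`, the limit of the `x^n`. -/
noncomputable def limitConfig (a b c d : ℕ) : ℤ × ℤ × ℤ → Cube :=
  limUnder atTop (surfaceConfig a b c d)

/-- The subshift `Z`: the `1`-zero-gluing closure of the orbit closure of the limit configuration.
The metric on `ℤ × ℤ × ℤ` is the supremum metric. -/
def subshiftZ (a b c d : ℕ) : Set (ℤ × ℤ × ℤ → Cube) :=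
  zeroGluingClosure 1 (orbitClosure (limitConfig a b c d))

end SparseSubshift

namespace SparseSubshift

/-! ## Zero-gluing subshifts -/

section Gluing

variable {G A : Type*}

/-! The surface is self-similar. Over a full image the bridges cancel and only the `2 * a` plain
rows keep the slope, so a surface of level `m + p` is the surface of level `p` stretched vertically
by `(2 * a) ^ m`, with macrotiles of level `m` placed on it (`height_add`, `cubeHeight_add`). The
finer levels disturb heights by at most the geometric sum `deviation` (`height_bounds`), which the
numerical hypothesis makes small against `b * (2 * a) ^ k` and `c * (2 * a) ^ k` (`deviation_lt`).
At scale `k + 1` a block therefore looks like five strips: the outer two stay near a base height,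
the second and fourth carry bridges rising by about `(b + c) * (2 * a) ^ k`, and the middle one a
bridge descending by about `b * (2 * a) ^ k` (`isSheet_cubeHeight`).

The zero-gluing closure is controlled from outside by `patchwork`: each component is a graph over
the horizontal plane, and each nonzero cell lies on a patch of the surface of every level. These
conditions are closed, shift-invariant and compatible with gluing, and the limit satisfies them, so
they hold throughout `subshiftZ`.

Three nonzero cells in one column of a patchwork lie in three components. Take `k` with `(2 * a) ^
k` larger than their distance, and the sheets of level `k + 1` through them. Sheets of different
components never touch, so their vertical order is constant over their overlap (`IsSheet.lt`). If
two sheets overlap enough, an outer strip of the upper one passes over a side bridge of the lower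
one, which separates their bases by about `b + c` units (`IsSheet.base_lt`); if they are nearly
aligned, the middle strip also passes over a side bridge and the separation grows by `b`
(`IsSheet.base_lt_of_near`). Two sheets can still come close at the column by using their bridges or
opposite ends, but three cannot do so at once (`not_three_sheets`).

Convergence holds because the centre of each macrotile lies on the flat central plateau, so
successive configurations agree near the origin. -/

theorem isZeroGluing_zeroGluingClosure [AddGroup G] [PseudoMetricSpace G] [Zero A] [TopologicalSpace A]
    (r : ℝ) (X : Set (G → A)) : IsZeroGluing r (zeroGluingClosure r X) := by
  refine ⟨⟨isClosed_sInter fun Y hY => hY.1.1.1, fun g x hx Y hY =>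
    hY.1.1.2 g x (hx Y hY)⟩, fun x => ⟨fun hx z hz Y hY => ?_, fun hx Y hY => ?_⟩⟩
  · exact (hY.1.2 x).1 (hx Y hY) z hz
  · exact (hY.1.2 x).2 fun z hz => hx z hz Y hY

theorem orbitClosure_subset [AddGroup G] [TopologicalSpace A] {X : Set (G → A)} (hX : IsSubshift X) {x : G → A}
    (hx : x ∈ X) : orbitClosure x ⊆ X :=
  closure_minimal (by rintro _ ⟨g, rfl⟩; exact hX.2 g x hx) hX.1

theorem eventually_apply_eq [TopologicalSpace A] [DiscreteTopology A] (x : G → A) (p : G) :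
    ∀ᶠ y in 𝓝 x, y p = x p :=
  ((continuous_apply p).tendsto x).eventually (p := fun w => w = x p) (by simp)


/-- Agreement on finitely many coordinates is a neighbourhood condition, since the alphabet is
discrete. -/
theorem isClosed_of_finite_support [TopologicalSpace A] [DiscreteTopology A] (S : Set (G → A))
    (B : Set G) (hB : B.Finite)
    (h : ∀ x y : G → A, (∀ p ∈ B, y p = x p) → y ∈ S → x ∈ S) : IsClosed S := by
  rw [← isOpen_compl_iff, isOpen_iff_mem_nhds]
  intro x hx
  have : ∀ᶠ y in 𝓝 x, ∀ p ∈ B, y p = x p :=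
    hB.eventually_all.2 fun p _ => eventually_apply_eq x p
  filter_upwards [this] with y hy hyS
  exact hx (h x y hy hyS)

variable [PseudoMetricSpace G] [Zero A]

theorem componentConfig_ne_zero {r : ℝ} {x : G → A} {u v : G} :
    componentConfig r x u v ≠ 0 ↔ (sightGraph r x).Reachable u v ∧ x v ≠ 0 := by
  unfold componentConfig
  split_ifs with h <;> simp [h]

theorem sightGraph_componentConfig_le (r : ℝ) (x : G → A) (u : G) :
    sightGraph r (componentConfig r x u) ≤ sightGraph r x := fun _ _ h =>
  ⟨h.1, (componentConfig_ne_zero.1 h.2.1).2, (componentConfig_ne_zero.1 h.2.2.1).2, h.2.2.2⟩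

/-- Every vertex of a walk that starts in the component of `u` stays in that component, so the walk
survives the erasure of the other cells. -/
theorem reachable_componentConfig {r : ℝ} {x : G → A} {u p q : G}
    (hup : (sightGraph r x).Reachable u p) (hpq : (sightGraph r x).Reachable p q) :
    (sightGraph r (componentConfig r x u)).Reachable p q := by
  obtain ⟨W⟩ := hpq
  induction W with
  | nil => rfl
  | cons h W ih =>
    have h2 := hup.trans h.reachable
    refine SimpleGraph.Reachable.trans (SimpleGraph.Adj.reachable ?_) (ih h2)
    exact ⟨h.1, componentConfig_ne_zero.2 ⟨hup, h.2.1⟩,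
      componentConfig_ne_zero.2 ⟨h2, h.2.2.1⟩, h.2.2.2⟩

theorem ne_zero_of_reachable {r : ℝ} {x : G → A} {p q : G} (h : (sightGraph r x).Reachable p q)
    (hne : p ≠ q) : x p ≠ 0 := by
  obtain ⟨W⟩ := h
  cases W with
  | nil => exact absurd rfl hne
  | cons h W => exact h.2.1

/-- A walk uses finitely many cells, so being connected is an open condition on the configuration.
-/
theorem eventually_reachable [TopologicalSpace A] [DiscreteTopology A] {r : ℝ} {x : G → A}
    {p q : G} (h : (sightGraph r x).Reachable p q) :
    ∀ᶠ y in 𝓝 x, (sightGraph r y).Reachable p q := by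
  obtain ⟨W⟩ := h
  induction W with
  | nil => exact Eventually.of_forall fun _ => SimpleGraph.Reachable.refl _
  | @cons u v w h W ih =>
    filter_upwards [ih, eventually_apply_eq x u, eventually_apply_eq x v] with y hy hu hv
    refine SimpleGraph.Reachable.trans (SimpleGraph.Adj.reachable ?_) hy
    exact ⟨h.1, by rw [hu]; exact h.2.1, by rw [hv]; exact h.2.2.1, h.2.2.2⟩

end Gluing

theorem dist_le_one_iff (u v : ℤ × ℤ × ℤ) :
    dist u v ≤ 1 ↔ |u.1 - v.1| ≤ 1 ∧ |u.2.1 - v.2.1| ≤ 1 ∧ |u.2.2 - v.2.2| ≤ 1 := by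
  simp only [Prod.dist_eq, sup_le_iff, Int.dist_eq]
  norm_cast

theorem reachable_shift {A : Type*} [Zero A] {x : ℤ × ℤ × ℤ → A} {g p q : ℤ × ℤ × ℤ}
    (h : (sightGraph 1 (shift g x)).Reachable p q) :
    (sightGraph 1 x).Reachable (-g + p) (-g + q) := by
  obtain ⟨W⟩ := h
  induction W with
  | nil => rfl
  | cons h W ih =>
    refine SimpleGraph.Reachable.trans (SimpleGraph.Adj.reachable ?_) ih
    refine ⟨fun e => h.1 (add_left_cancel e), h.2.1, h.2.2.1, ?_⟩
    have := (dist_le_one_iff _ _).1 h.2.2.2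
    rw [dist_le_one_iff]
    simpa using this

/-! ## Heights of macrotiles -/

theorem abs_rise_le (s : Slope) : |s.rise| ≤ 1 := by
  cases s <;> simp [Slope.rise]

/-- The low `m` digits of the coordinates locate a tile inside its block of level `m`; the remaining
digits locate the block. -/
theorem macrotile_add (a b c d m p : ℕ) (t : Tile) (i j : ℕ) :
    macrotile a b c d (m + p) t i j =
      macrotile a b c d m (macrotile a b c d p t (i / 5 ^ m) (j / len a b c d ^ m))
        (i % 5 ^ m) (j % len a b c d ^ m) := by
  induction m generalizing i j with
  | zero => simp [macrotile]
  | succ m ih =>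
    rw [show m + 1 + p = (m + p) + 1 by ring]
    simp only [macrotile]
    rw [ih, Nat.div_div_eq_div_mul, Nat.div_div_eq_div_mul, ← pow_succ', ← pow_succ']
    congr 1
    · rw [pow_succ' 5, pow_succ' (len a b c d), Nat.mod_mul_right_div_self,
        Nat.mod_mul_right_div_self]
    · rw [pow_succ', Nat.mod_mul_right_mod]
    · rw [pow_succ', Nat.mod_mul_right_mod]

theorem height_succ_right (a b c d n : ℕ) (t : Tile) (i j : ℕ) :
    height a b c d n t i (j + 1) =
      height a b c d n t i j + (macrotile a b c d n t i j).slope.rise := by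
  unfold height
  rw [Finset.sum_range_succ]

theorem height_succ_level {a b c d : ℕ} (hL : 0 < len a b c d) (n : ℕ) (t : Tile) (i j : ℕ) :
    height a b c d (n + 1) t i j =
      height a b c d n t (i / 5) (j / len a b c d) * (2 * a) +
        ∑ m ∈ Finset.range (j % len a b c d),
          (plainImage a b c d (macrotile a b c d n t (i / 5) (j / len a b c d)).slope
            (i % 5) m).slope.rise := by
  conv_lhs => rw [← Nat.div_add_mod j (len a b c d)]
  exact height_succ a b c d n t i _ _ (Nat.mod_lt _ hL)

theorem height_add {a b c d : ℕ} (hL : 0 < len a b c d) (m p : ℕ) (t : Tile) (i j : ℕ) :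
    height a b c d (m + p) t i j =
      height a b c d p t (i / 5 ^ m) (j / len a b c d ^ m) * (2 * a) ^ m +
      height a b c d m (macrotile a b c d p t (i / 5 ^ m) (j / len a b c d ^ m))
        (i % 5 ^ m) (j % len a b c d ^ m) := by
  induction m generalizing i j with
  | zero => simp [height, Nat.mod_one]
  | succ m ih =>
    rw [show m + 1 + p = (m + p) + 1 by ring, height_succ_level hL, height_succ_level hL, ih,
      macrotile_add]
    rw [Nat.div_div_eq_div_mul, Nat.div_div_eq_div_mul, ← pow_succ', ← pow_succ']
    have h1 : ∀ x y : ℕ, x % y ^ (m + 1) / y = x / y % y ^ m := fun x y => by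
      rw [pow_succ', Nat.mod_mul_right_div_self]
    have h2 : ∀ x y : ℕ, x % y ^ (m + 1) % y = x % y := fun x y => by
      rw [pow_succ', Nat.mod_mul_right_mod]
    simp only [h1, h2]
    ring

theorem cubeHeight_add {a b c d : ℕ} (hL : 0 < len a b c d) (m p : ℕ) (t : Tile) (i j : ℕ) :
    cubeHeight a b c d (m + p) t i j =
      height a b c d p t (i / 5 ^ m) (j / len a b c d ^ m) * (2 * a) ^ m +
      cubeHeight a b c d m (macrotile a b c d p t (i / 5 ^ m) (j / len a b c d ^ m))
        (i % 5 ^ m) (j % len a b c d ^ m) := by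
  unfold cubeHeight
  rw [height_add hL, macrotile_add, ← min_add_add_left]
  ring_nf

theorem cubeHeight_eq_min (a b c d n : ℕ) (t : Tile) (i j : ℕ) :
    cubeHeight a b c d n t i j =
      min (height a b c d n t i j) (height a b c d n t i (j + 1)) := by
  rw [height_succ_right]; rfl

theorem abs_cubeHeight_succ_sub_le (a b c d n : ℕ) (t : Tile) (i j : ℕ) :
    |cubeHeight a b c d n t i (j + 1) - cubeHeight a b c d n t i j| ≤ 1 := by
  have h1 := abs_rise_le (macrotile a b c d n t i j).slope
  have h2 := abs_rise_le (macrotile a b c d n t i (j + 1)).slope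
  rw [cubeHeight_eq_min, cubeHeight_eq_min, height_succ_right a b c d n t i (j + 1),
    height_succ_right a b c d n t i j]
  rw [abs_le] at *
  omega

theorem abs_cubeHeight_sub_le (a b c d n : ℕ) (t : Tile) (i j k : ℕ) :
    |cubeHeight a b c d n t i (j + k) - cubeHeight a b c d n t i j| ≤ k := by
  induction k with
  | zero => simp
  | succ k ih =>
    have := abs_cubeHeight_succ_sub_le a b c d n t i (j + k)
    rw [← add_assoc]
    push_cast
    rw [abs_le] at *
    omega

theorem macrotile_zero_slope {a : ℕ} (ha : 0 < a) (b c d n : ℕ) (t : Tile) (i : ℕ) :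
    (macrotile a b c d n t i 0).slope = t.slope := by
  induction n generalizing i with
  | zero => rfl
  | succ n ih => simp [macrotile, tau, plainImage, ha, plainRow, ih]

/-- The cubes on the southmost row of a macrotile lie on the same level. -/
theorem cubeHeight_zero_right {a : ℕ} (ha : 0 < a) (b c d n : ℕ) (t : Tile) (i : ℕ) :
    cubeHeight a b c d n t i 0 = min 0 t.slope.rise := by
  simp [cubeHeight, height, macrotile_zero_slope ha]

/-- The accumulated deviation `(b + c) (1 + 2a + ⋯ + (2a)^(n-1))`. -/
def deviation (a b c : ℕ) : ℕ → ℤ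
  | 0 => 0
  | n + 1 => 2 * a * deviation a b c n + (b + c)

theorem deviation_eq (a b c n : ℕ) :
    (2 * a - 1) * deviation a b c n = (b + c) * ((2 * a) ^ n - 1) := by
  induction n with
  | zero => simp [deviation]
  | succ n ih =>
    rw [deviation, pow_succ]
    linear_combination (2 * a : ℤ) * ih

/-- The shape of the columns of a plain image: the height gained on the plain rows, and the number
of rows crossed in each of the four groups of sloped bridge rows. -/
theorem exists_sum_plainImage_eq {a b c d r : ℕ} (hr : r ≤ len a b c d) :
    ∃ m₀ m₁ m₂ m₃ m₄ : ℤ, (0 ≤ m₀ ∧ m₀ ≤ 2 * a) ∧ (0 ≤ m₄ ∧ m₄ ≤ m₁ ∧ m₁ ≤ b) ∧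
      (0 ≤ m₃ ∧ m₃ ≤ m₂ ∧ m₂ ≤ c) ∧
      (a + b + c ≤ r → r ≤ a + b + c + d → m₁ = b ∧ m₂ = c ∧ m₃ = 0 ∧ m₄ = 0) ∧
      ∀ (s : Slope) (i : ℕ), ∑ m ∈ Finset.range r, (plainImage a b c d s i m).slope.rise =
        s.rise * m₀ + match i with
          | 0 => 0
          | 1 | 3 => m₁ + m₂ - m₃ - m₄
          | 2 => m₄ - m₁
          | _ => 0 := by
  unfold len at hr
  refine ⟨((min r a + (r - (a + b + c + d + c + b)) : ℕ) : ℤ), ((min (r - a) b : ℕ) : ℤ),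
    ((min (r - (a + b)) c : ℕ) : ℤ), ((min (r - (a + b + c + d)) c : ℕ) : ℤ),
    ((min (r - (a + b + c + d + c)) b : ℕ) : ℤ), ⟨by positivity, by norm_cast; omega⟩,
    ⟨by positivity, by norm_cast; omega, by norm_cast; omega⟩,
    ⟨by positivity, by norm_cast; omega, by norm_cast; omega⟩, fun h1 h2 => ?_, fun s i => ?_⟩
  · norm_cast
    omega
  · rw [sum_plainImage]
    rcases i with _ | _ | _ | _ | i <;> simp only [Nat.cast_add] <;> ring

theorem sum_plainImage_bounds {a b c d : ℕ} (s : Slope) (i : ℕ) {r : ℕ} (hr : r ≤ len a b c d) :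
    min 0 s.rise * (2 * a) - (b + c) ≤
        ∑ m ∈ Finset.range r, (plainImage a b c d s i m).slope.rise ∧
      ∑ m ∈ Finset.range r, (plainImage a b c d s i m).slope.rise ≤
        max 0 s.rise * (2 * a) + (b + c) := by
  obtain ⟨m₀, m₁, m₂, m₃, m₄, h0, h1, h2, -, h⟩ := exists_sum_plainImage_eq hr
  rw [h]
  rcases i with _ | _ | _ | _ | i <;> cases s <;> simp [Slope.rise] <;> omega

/-- One level multiplies the previous bounds by `2 * a` and adds one bridge excursion, at most `b +
c`; this is the recursion that defines `deviation`. -/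
theorem height_bounds {a b c d : ℕ} (hL : 0 < len a b c d) (n : ℕ) (t : Tile) (i j : ℕ)
    (hj : j ≤ len a b c d ^ n) :
    min 0 t.slope.rise * (2 * a) ^ n - deviation a b c n ≤ height a b c d n t i j ∧
      height a b c d n t i j ≤ max 0 t.slope.rise * (2 * a) ^ n + deviation a b c n := by
  induction n generalizing i j with
  | zero =>
    obtain rfl | rfl : j = 0 ∨ j = 1 := by simp at hj; omega
    · simp [height, deviation]
    · simp [height, deviation, macrotile]
  | succ n ih =>
    rcases hj.eq_or_lt with rfl | hj
    -- The north border of the macrotile is the south edge of a row that is no longer part of it; no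
    -- partial image is crossed there.
    · have key : height a b c d (n + 1) t i (len a b c d ^ (n + 1)) =
          height a b c d n t (i / 5) (len a b c d ^ n) * (2 * a) := by
        rw [height_succ_level hL, pow_succ, Nat.mul_div_cancel _ hL]
        simp
      rw [key, deviation, pow_succ]
      have := ih (i / 5) (len a b c d ^ n) le_rfl
      constructor
      · nlinarith [mul_le_mul_of_nonneg_right this.1 (show (0 : ℤ) ≤ 2 * a by positivity)]
      · nlinarith [mul_le_mul_of_nonneg_right this.2 (show (0 : ℤ) ≤ 2 * a by positivity)]
    · have hq : j / len a b c d < len a b c d ^ n :=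
        Nat.div_lt_of_lt_mul (by rwa [← pow_succ'])
      have h1 := ih (i / 5) (j / len a b c d) hq.le
      have h2 := ih (i / 5) (j / len a b c d + 1) hq
      rw [height_succ_right] at h2
      rw [height_succ_level hL, deviation, pow_succ]
      have h3 := sum_plainImage_bounds (a := a) (b := b) (c := c)
        (macrotile a b c d n t (i / 5) (j / len a b c d)).slope (i % 5)
        (Nat.mod_lt j hL).le
      generalize ∑ m ∈ Finset.range (j % len a b c d), (plainImage a b c d (macrotile a b c d n t
        (i / 5) (j / len a b c d)).slope (i % 5) m).slope.rise = P at *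
      generalize (macrotile a b c d n t (i / 5) (j / len a b c d)).slope.rise = σ at *
      generalize height a b c d n t (i / 5) (j / len a b c d) = H at *
      -- The induction hypothesis is used at both edges of the coarse tile. This absorbs the slope
      -- of that tile, which would otherwise cost an extra `2 * a` at each level.
      have h4 : min 0 t.slope.rise * (2 * a) ^ n - deviation a b c n ≤ H + min 0 σ := by
        rcases min_cases 0 σ with h | h <;> rw [h.1] <;> linarith [h1.1, h2.1]
      have h5 : H + max 0 σ ≤ max 0 t.slope.rise * (2 * a) ^ n + deviation a b c n := by
        rcases max_cases 0 σ with h | h <;> rw [h.1] <;> linarith [h1.2, h2.2]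
      have ha : (0 : ℤ) ≤ 2 * a := by positivity
      constructor
      · nlinarith [mul_le_mul_of_nonneg_right h4 ha, h3.1]
      · nlinarith [mul_le_mul_of_nonneg_right h5 ha, h3.2]

theorem cubeHeight_bounds {a b c d : ℕ} (hL : 0 < len a b c d) (n : ℕ) (t : Tile) (i j : ℕ)
    (hj : j < len a b c d ^ n) :
    min 0 t.slope.rise * (2 * a) ^ n - deviation a b c n ≤ cubeHeight a b c d n t i j ∧
      cubeHeight a b c d n t i j ≤ max 0 t.slope.rise * (2 * a) ^ n + deviation a b c n := by
  rw [cubeHeight_eq_min]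
  have h1 := height_bounds hL n t i j hj.le
  have h2 := height_bounds hL n t i (j + 1) hj
  exact ⟨le_min h1.1 h2.1, (min_le_left _ _).trans h1.2⟩

/-- Bounds on the level-one heights of a column of macrotiles give bounds on the heights of the
cubes. -/
theorem cubeHeight_succ_bounds {a b c d : ℕ} (hL : 0 < len a b c d) (k : ℕ) (t : Tile) (i j : ℕ)
    (lo hi : ℤ)
    (h0 : lo ≤ height a b c d 1 t (i / 5 ^ k) (j / len a b c d ^ k) ∧
      height a b c d 1 t (i / 5 ^ k) (j / len a b c d ^ k) ≤ hi)
    (h1 : lo ≤ height a b c d 1 t (i / 5 ^ k) (j / len a b c d ^ k + 1) ∧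
      height a b c d 1 t (i / 5 ^ k) (j / len a b c d ^ k + 1) ≤ hi) :
    lo * (2 * a) ^ k - deviation a b c k ≤ cubeHeight a b c d (k + 1) t i j ∧
      cubeHeight a b c d (k + 1) t i j ≤ hi * (2 * a) ^ k + deviation a b c k := by
  rw [cubeHeight_add hL]
  have h2 := cubeHeight_bounds (a := a) (b := b) (c := c) hL k
    (macrotile a b c d 1 t (i / 5 ^ k) (j / len a b c d ^ k)) (i % 5 ^ k)
    (j % len a b c d ^ k) (Nat.mod_lt _ (pow_pos hL k))
  rw [height_succ_right] at h1
  generalize cubeHeight a b c d k _ (i % 5 ^ k) (j % len a b c d ^ k) = P at *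
  generalize (macrotile a b c d 1 t (i / 5 ^ k) (j / len a b c d ^ k)).slope.rise = σ at *
  generalize height a b c d 1 t (i / 5 ^ k) (j / len a b c d ^ k) = H at *
  have ha : (0 : ℤ) ≤ (2 * a) ^ k := by positivity
  have h4 : lo ≤ H + min 0 σ := by
    rcases min_cases 0 σ with h | h <;> rw [h.1] <;> linarith [h0.1, h1.1]
  have h5 : H + max 0 σ ≤ hi := by
    rcases max_cases 0 σ with h | h <;> rw [h.1] <;> linarith [h0.2, h1.2]
  constructor
  · nlinarith [mul_le_mul_of_nonneg_right h4 ha, h2.1]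
  · nlinarith [mul_le_mul_of_nonneg_right h5 ha, h2.2]

theorem height_one {a b c d : ℕ} (t : Tile) (i r : ℕ) (hi : i < 5) (hr : r ≤ len a b c d) :
    height a b c d 1 t i r =
      ∑ m ∈ Finset.range r, (plainImage a b c d t.slope i m).slope.rise := by
  unfold height
  refine Finset.sum_congr rfl fun m hm => ?_
  have := (Finset.mem_range.1 hm).trans_le hr
  simp [macrotile, tau, Nat.mod_eq_of_lt hi, Nat.mod_eq_of_lt this]

theorem height_one_edge {a b c d : ℕ} (t : Tile) {i r : ℕ} (hi : i = 0 ∨ i = 4)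
    (hr : r ≤ len a b c d) :
    -(2 * a : ℤ) ≤ height a b c d 1 t i r ∧ height a b c d 1 t i r ≤ 2 * a := by
  obtain ⟨m₀, m₁, m₂, m₃, m₄, h0, h1, h2, -, h⟩ := exists_sum_plainImage_eq hr
  rw [height_one t i r (by omega) hr, h]
  rcases hi with rfl | rfl <;> cases t.slope <;> simp [Slope.rise] <;> omega

theorem height_one_side {a b c d : ℕ} (t : Tile) {i r : ℕ} (hi : i = 1 ∨ i = 3)
    (hr : r ≤ len a b c d) :
    -(2 * a : ℤ) ≤ height a b c d 1 t i r ∧ height a b c d 1 t i r ≤ 2 * a + (b + c) := by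
  obtain ⟨m₀, m₁, m₂, m₃, m₄, h0, h1, h2, -, h⟩ := exists_sum_plainImage_eq hr
  rw [height_one t i r (by omega) hr, h]
  rcases hi with rfl | rfl <;> cases t.slope <;> simp only [Slope.rise] <;> omega

theorem height_one_mid {a b c d : ℕ} (t : Tile) {r : ℕ} (hr : r ≤ len a b c d) :
    -(2 * a + b : ℤ) ≤ height a b c d 1 t 2 r ∧ height a b c d 1 t 2 r ≤ 2 * a := by
  obtain ⟨m₀, m₁, m₂, m₃, m₄, h0, h1, h2, -, h⟩ := exists_sum_plainImage_eq hr
  rw [height_one t 2 r (by omega) hr, h]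
  cases t.slope <;> simp only [Slope.rise] <;> omega

theorem height_one_side_plateau {a b c d : ℕ} (t : Tile) {i r : ℕ} (hi : i = 1 ∨ i = 3)
    (h1 : a + b + c ≤ r) (h2 : r ≤ a + b + c + d) :
    (b + c : ℤ) - 2 * a ≤ height a b c d 1 t i r := by
  have hr : r ≤ len a b c d := by unfold len; omega
  obtain ⟨m₀, m₁, m₂, m₃, m₄, h0, -, -, h3, h⟩ := exists_sum_plainImage_eq hr
  obtain ⟨rfl, rfl, rfl, rfl⟩ := h3 h1 h2
  rw [height_one t i r (by omega) hr, h]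
  rcases hi with rfl | rfl <;> cases t.slope <;> simp only [Slope.rise] <;> omega

theorem height_one_mid_plateau {a b c d : ℕ} (t : Tile) {r : ℕ}
    (h1 : a + b + c ≤ r) (h2 : r ≤ a + b + c + d) :
    height a b c d 1 t 2 r ≤ 2 * a - b := by
  have hr : r ≤ len a b c d := by unfold len; omega
  obtain ⟨m₀, m₁, m₂, m₃, m₄, h0, -, -, h3, h⟩ := exists_sum_plainImage_eq hr
  obtain ⟨rfl, rfl, rfl, rfl⟩ := h3 h1 h2
  rw [height_one t 2 r (by omega) hr, h]
  cases t.slope <;> simp only [Slope.rise] <;> omega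

/-! ## Stacked sheets

A sheet is the height function of a block of the surface and of its southern and northern
neighbours, near a cell with coordinates `(0, 0)` that belongs to the block. -/

/-- `f` is the height function of a sheet over a block whose southwest corner is `(X, Y)`, which
consists of five columns of width `w` and has length `l`. Up to an error `K`, the outer columns are
at height `α`, the bridges of the second and fourth columns rise by `h`, and the bridge of the
central column descends by `b`. The bridges are level outside of the first and last `q` rows of a
block. -/
structure IsSheet (w l q h b K X Y α : ℤ) (f : ℤ → ℤ → ℤ) : Prop where
  west : X ≤ 0
  east : 0 < X + 5 * w
  south : Y ≤ 0
  north : 0 < Y + l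
  step : ∀ x y, X ≤ x → x < X + 5 * w → -l ≤ y → y + 1 < l → |f x (y + 1) - f x y| ≤ 1
  base : ∀ x x', X ≤ x → x < X + 5 * w → X ≤ x' → x' < X + 5 * w → f x Y = f x' Y
  edge : ∀ x y, X ≤ x → x < X + 5 * w → (x < X + w ∨ X + 4 * w ≤ x) → -l ≤ y → y < l →
    α - K ≤ f x y ∧ f x y ≤ α + K
  side : ∀ x y, (X + w ≤ x ∧ x < X + 2 * w ∨ X + 3 * w ≤ x ∧ x < X + 4 * w) → -l ≤ y → y < l →
    α - K ≤ f x y ∧ f x y ≤ α + h + K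
  mid : ∀ x y, X + 2 * w ≤ x → x < X + 3 * w → -l ≤ y → y < l →
    α - b - K ≤ f x y ∧ f x y ≤ α + K
  side_plateau : ∀ x y s, (X + w ≤ x ∧ x < X + 2 * w ∨ X + 3 * w ≤ x ∧ x < X + 4 * w) →
    -l ≤ y → y < l → Y + s * l + q ≤ y → y < Y + (s + 1) * l - q → α + h - K ≤ f x y
  mid_plateau : ∀ x y s, X + 2 * w ≤ x → x < X + 3 * w →
    -l ≤ y → y < l → Y + s * l + q ≤ y → y < Y + (s + 1) * l - q → f x y ≤ α - b + K

/-- Cells of the two sheets that lie in the same column or in columns next to each other in the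
west-east direction are not close to each other. -/
def Apart (w l X X' : ℤ) (f g : ℤ → ℤ → ℤ) : Prop :=
  ∀ x x' y, X ≤ x → x < X + 5 * w → X' ≤ x' → x' < X' + 5 * w → |x - x'| ≤ 1 → -l ≤ y → y < l →
    2 ≤ |f x y - g x' y|

section Sheets

variable {w l q h b K X Y α X' Y' β X'' Y'' γ : ℤ} {f g k : ℤ → ℤ → ℤ}

theorem Apart.symm (H : Apart w l X X' f g) : Apart w l X' X g f := by
  intro x x' y h1 h2 h3 h4 h5 h6 h7
  rw [abs_sub_comm]
  exact H x' x y h3 h4 h1 h2 (by rwa [abs_sub_comm]) h6 h7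

/-- The order of two sheets is constant along a column. -/
theorem IsSheet.lt_of_lt (hf : IsSheet w l q h b K X Y α f) (hg : IsSheet w l q h b K X' Y' β g)
    (H : Apart w l X X' f g) {x x' : ℤ} (h1 : X ≤ x) (h2 : x < X + 5 * w) (h3 : X' ≤ x')
    (h4 : x' < X' + 5 * w) (h5 : |x - x'| ≤ 1) {y z : ℤ} (hy : -l ≤ y) (hy' : y < l)
    (hz : -l ≤ z) (hz' : z < l) (hlt : g x' y < f x y) : g x' z < f x z := by
  -- In one step the difference of the two heights changes by at most 2, whereas its absolute value
  -- is at least 2 before and after; it cannot change sign.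
  have step : ∀ v, -l ≤ v → v + 1 < l → (g x' v < f x v ↔ g x' (v + 1) < f x (v + 1)) := by
    intro v hv hv'
    have e1 := hf.step x v h1 h2 hv hv'
    have e2 := hg.step x' v h3 h4 hv hv'
    have e3 := H x x' v h1 h2 h3 h4 h5 hv (by omega)
    have e4 := H x x' (v + 1) h1 h2 h3 h4 h5 (by omega) hv'
    rw [abs_le] at e1 e2
    rw [le_abs] at e3 e4
    omega
  have key : ∀ n : ℕ, -l + n < l → (g x' (-l) < f x (-l) ↔ g x' (-l + n) < f x (-l + n)) := by
    intro n
    induction n with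
    | zero => simp
    | succ n ih =>
      intro hn
      push_cast at hn ⊢
      rw [ih (by omega), step (-l + n) (by omega) (by omega), add_assoc]
  have h6 := key (y + l).toNat (by omega)
  have h7 := key (z + l).toNat (by omega)
  rw [show -l + ((y + l).toNat : ℤ) = y by omega] at h6
  rw [show -l + ((z + l).toNat : ℤ) = z by omega] at h7
  exact h7.1 (h6.2 hlt)

/-- Along the base row of `f` all its columns are level. The order is carried to that row, the
column of `f` is exchanged there, and the order is carried back to row 0. -/
theorem IsSheet.move_left (hf : IsSheet w l q h b K X Y α f)
    (hg : IsSheet w l q h b K X' Y' β g) (H : Apart w l X X' f g) {x x' z : ℤ}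
    (h1 : X ≤ x) (h2 : x < X + 5 * w) (h3 : X' ≤ x') (h4 : x' < X' + 5 * w)
    (h1' : X ≤ z) (h2' : z < X + 5 * w)
    (h5 : |x - x'| ≤ 1) (h6 : |z - x'| ≤ 1) (hlt : g x' 0 < f x 0) : g x' 0 < f z 0 := by
  have := hf.south
  have := hf.north
  have e := hf.lt_of_lt hg H h1 h2 h3 h4 h5 (by omega) (by omega) (show -l ≤ Y by omega)
    (by omega) hlt
  rw [hf.base x z h1 h2 h1' h2'] at e
  exact hf.lt_of_lt hg H h1' h2' h3 h4 h6 (by omega) (by omega) (by omega) (by omega) e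

theorem IsSheet.move_right (hf : IsSheet w l q h b K X Y α f)
    (hg : IsSheet w l q h b K X' Y' β g) (H : Apart w l X X' f g) {x x' z : ℤ}
    (h1 : X ≤ x) (h2 : x < X + 5 * w) (h3 : X' ≤ x') (h4 : x' < X' + 5 * w)
    (h1' : X' ≤ z) (h2' : z < X' + 5 * w)
    (h5 : |x - x'| ≤ 1) (h6 : |x - z| ≤ 1) (hlt : g x' 0 < f x 0) : g z 0 < f x 0 := by
  have := hg.south
  have := hg.north
  have e := hf.lt_of_lt hg H h1 h2 h3 h4 h5 (by omega) (by omega) (show -l ≤ Y' by omega)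
    (by omega) hlt
  rw [hg.base x' z h3 h4 h1' h2'] at e
  exact hf.lt_of_lt hg H h1 h2 h1' h2' h6 (by omega) (by omega) (by omega) (by omega) e

/-- The order of two sheets is the same everywhere. -/
theorem IsSheet.lt (hf : IsSheet w l q h b K X Y α f) (hg : IsSheet w l q h b K X' Y' β g)
    (H : Apart w l X X' f g) (h0 : g 0 0 < f 0 0) {x x' : ℤ} (h1 : X ≤ x) (h2 : x < X + 5 * w)
    (h3 : X' ≤ x') (h4 : x' < X' + 5 * w) (h5 : |x - x'| ≤ 1) {y : ℤ} (hy : -l ≤ y)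
    (hy' : y < l) : g x' y < f x y := by
  have w1 := hf.west
  have w2 := hf.east
  have w3 := hg.west
  have w4 := hg.east
  -- From the common cell over the origin the comparison spreads one column at a time, moving first
  -- the upper and then the lower sheet.
  have east : ∀ n : ℕ, n < X + 5 * w → n < X' + 5 * w → g n 0 < f n 0 := by
    intro n
    induction n with
    | zero => intro _ _; simpa using h0
    | succ n ih =>
      intro e1 e2
      push_cast at e1 e2 ⊢
      have e3 := ih (by omega) (by omega)
      have e4 := hf.move_left hg H (x := n) (x' := n) (z := n + 1) (by omega) (by omega) (by omega)
        (by omega) (by omega) (by omega) (by simp) (by simp) e3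
      exact hf.move_right hg H (x := n + 1) (x' := n) (z := n + 1) (by omega) (by omega) (by omega)
        (by omega) (by omega) (by omega) (by simp) (by simp) e4
  have west : ∀ n : ℕ, X ≤ -n → X' ≤ -n → g (-n) 0 < f (-n) 0 := by
    intro n
    induction n with
    | zero => intro _ _; simpa using h0
    | succ n ih =>
      intro e1 e2
      push_cast at e1 e2 ⊢
      have e3 := ih (by omega) (by omega)
      have e4 := hf.move_left hg H (x := -n) (x' := -n) (z := -(n + 1)) (by omega) (by omega)
        (by omega) (by omega) (by omega) (by omega) (by simp) (by simp) e3
      exact hf.move_right hg H (x := -(n + 1)) (x' := -n) (z := -(n + 1)) (by omega) (by omega)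
        (by omega) (by omega) (by omega) (by omega) (by simp) (by simp) e4
  have diag : ∀ v, X ≤ v → v < X + 5 * w → X' ≤ v → v < X' + 5 * w → g v 0 < f v 0 := by
    intro v e1 e2 e3 e4
    rcases le_total 0 v with hv | hv
    · have := east v.toNat (by omega) (by omega)
      rwa [Int.toNat_of_nonneg hv] at this
    · have := west (-v).toNat (by omega) (by omega)
      rwa [Int.toNat_of_nonneg (by omega), neg_neg] at this
  have n1 := hf.south
  have n2 := hf.north
  refine hf.lt_of_lt hg H h1 h2 h3 h4 h5 (y := 0) (by omega) (by omega) hy hy' ?_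
  -- If `x` is not a column of the lower block, then its neighbour `x'` is a column of the upper
  -- one.
  by_cases hx : X' ≤ x ∧ x < X' + 5 * w
  · exact hf.move_right hg H h1 h2 hx.1 hx.2 h3 h4 (by simp) h5 (diag x h1 h2 hx.1 hx.2)
  · have h5' := abs_le.1 h5
    have hx' : X ≤ x' ∧ x' < X + 5 * w := by omega
    exact hf.move_left hg H hx'.1 hx'.2 h3 h4 h1 h2 (by simp) h5 (diag x' hx'.1 hx'.2 h3 h4)

/-- The outer columns of the upper one of two overlapping sheets pass above the bridges of the
lower one. -/
theorem IsSheet.base_lt (hf : IsSheet w l q h b K X Y α f) (hg : IsSheet w l q h b K X' Y' β g)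
    (hq : 0 ≤ q) (hql : 4 * q < l) (hl : 0 < l) (H : Apart w l X X' f g) (h0 : g 0 0 < f 0 0)
    (h1 : X < X' + 4 * w) (h2 : X' < X + 4 * w) : β + h - 2 * K < α := by
  have w1 := hf.west
  have w2 := hf.east
  have w3 := hg.west
  have w4 := hg.east
  have hw : 0 < w := by omega
  have n1 := hg.south
  have n2 := hg.north
  -- An outer strip of `f` meets or touches a side strip of `g` for every offset below `4 * w`. When
  -- the blocks are aligned the strips are only adjacent, which is why neighbouring columns count in
  -- `Apart`.
  obtain ⟨x, x', e1, e2, e3, e4, e5⟩ : ∃ x x', X ≤ x ∧ x < X + 5 * w ∧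
      (x < X + w ∨ X + 4 * w ≤ x) ∧
      (X' + w ≤ x' ∧ x' < X' + 2 * w ∨ X' + 3 * w ≤ x' ∧ x' < X' + 4 * w) ∧ |x - x'| ≤ 1 := by
    simp only [abs_le]
    rcases le_total X X' with h | h
    · rcases lt_or_ge X' (X + w) with e | e
      · exact ⟨X' + 4 * w, X' + 4 * w - 1, by omega, by omega, by omega, by omega, by omega⟩
      rcases lt_or_ge X' (X + 2 * w) with e | e
      · exact ⟨X' + 3 * w, X' + 3 * w, by omega, by omega, by omega, by omega, by omega⟩
      rcases lt_or_ge X' (X + 3 * w) with e | e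
      · exact ⟨X' + 2 * w, X' + 2 * w - 1, by omega, by omega, by omega, by omega, by omega⟩
      · exact ⟨X' + w, X' + w, by omega, by omega, by omega, by omega, by omega⟩
    · rcases lt_or_ge X (X' + w) with e | e
      · exact ⟨X + w - 1, X + w, by omega, by omega, by omega, by omega, by omega⟩
      rcases lt_or_ge X (X' + 2 * w) with e | e
      · exact ⟨X, X, by omega, by omega, by omega, by omega, by omega⟩
      rcases lt_or_ge X (X' + 3 * w) with e | e
      · exact ⟨X + w - 1, X + w, by omega, by omega, by omega, by omega, by omega⟩
      · exact ⟨X, X, by omega, by omega, by omega, by omega, by omega⟩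
  -- This is the first row of the plateau of the block of `g`.
  have hy : -l ≤ Y' + q ∧ Y' + q < l := by omega
  have k1 := hf.lt hg H h0 e1 e2 (by omega) (by omega) e5 hy.1 hy.2
  have k2 := (hf.edge x _ e1 e2 e3 hy.1 hy.2).2
  have k3 := hg.side_plateau x' _ 0 e4 hy.1 hy.2 (by omega) (by omega)
  omega

/-- If the central column of the upper sheet passes above a bridge of the lower one, then the upper
sheet is even higher. -/
theorem IsSheet.base_lt_of_near (hf : IsSheet w l q h b K X Y α f)
    (hg : IsSheet w l q h b K X' Y' β g)
    (hq : 0 ≤ q) (hql : 4 * q < l) (hl : 0 < l) (H : Apart w l X X' f g) (h0 : g 0 0 < f 0 0)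
    (h1 : X < X' + 2 * w) (h2 : X' < X + 2 * w) : β + h + b - 2 * K < α := by
  have w1 := hf.west
  have w2 := hf.east
  have w3 := hg.west
  have w4 := hg.east
  have hw : 0 < w := by omega
  have n1 := hf.south
  have n2 := hf.north
  have n3 := hg.south
  have n4 := hg.north
  obtain ⟨x, x', e1, e2, e4, e5⟩ : ∃ x x', X + 2 * w ≤ x ∧ x < X + 3 * w ∧
      (X' + w ≤ x' ∧ x' < X' + 2 * w ∨ X' + 3 * w ≤ x' ∧ x' < X' + 4 * w) ∧ |x - x'| ≤ 1 := by
    simp only [abs_le]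
    rcases le_total X X' with h | h
    · rcases lt_or_ge X' (X + w) with e | e
      · exact ⟨X' + 2 * w, X' + 2 * w - 1, by omega, by omega, by omega, by omega⟩
      · exact ⟨X' + w, X' + w, by omega, by omega, by omega, by omega⟩
    · rcases lt_or_ge X (X' + w) with e | e
      · exact ⟨X + 3 * w - 1, X + 3 * w, by omega, by omega, by omega, by omega⟩
      · exact ⟨X + 2 * w, X + 2 * w, by omega, by omega, by omega, by omega⟩
  -- A row on plateaus of both sheets is needed. The non-plateau rows of `g` around a border form a
  -- gap of length `2 * q`: if `Y + q` falls in it, then `Y + 3 * q` is past it, and `4 * q < l`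
  -- keeps this row on the plateau of `f`.
  obtain ⟨y, s, hy, hy', hs, hs', ht, ht'⟩ : ∃ y s, -l ≤ y ∧ y < l ∧
      Y + 0 * l + q ≤ y ∧ y < Y + (0 + 1) * l - q ∧
      Y' + s * l + q ≤ y ∧ y < Y' + (s + 1) * l - q := by
    rcases lt_or_ge (Y + q) (Y' - q) with c1 | c1
    · refine ⟨Y + q, -1, ?_, ?_, ?_, ?_, ?_, ?_⟩ <;> omega
    rcases lt_or_ge (Y + q) (Y' + q) with c2 | c2
    · refine ⟨Y + 3 * q, 0, ?_, ?_, ?_, ?_, ?_, ?_⟩ <;> omega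
    rcases lt_or_ge (Y + q) (Y' + l - q) with c3 | c3
    · refine ⟨Y + q, 0, ?_, ?_, ?_, ?_, ?_, ?_⟩ <;> omega
    · refine ⟨Y + 3 * q, 1, ?_, ?_, ?_, ?_, ?_, ?_⟩ <;> omega
  have k1 := hf.lt hg H h0 (by omega) (by omega) (by omega) (by omega) e5 hy hy'
  have k2 := hf.mid_plateau x _ 0 e1 e2 hy hy' hs hs'
  have k3 := hg.side_plateau x' _ s e4 hy hy' ht ht'
  omega

/-- The separations of the bases are played against the heights that the three sheets can have over
the origin, where they differ by at most `u`. The position of the origin among the five strips of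
each sheet decides which separations are available. -/
theorem not_three_sheets {c u : ℤ} (hf : IsSheet w l q (b + c) b K X Y α f)
    (hg : IsSheet w l q (b + c) b K X' Y' β g) (hk : IsSheet w l q (b + c) b K X'' Y'' γ k)
    (hq : 0 ≤ q) (hql : 4 * q < l) (hl : 0 < l)
    (Hfg : Apart w l X X' f g) (Hgk : Apart w l X' X'' g k) (Hfk : Apart w l X X'' f k)
    (hfg : g 0 0 < f 0 0) (hgk : k 0 0 < g 0 0) (hfk : f 0 0 ≤ k 0 0 + u)
    (hK : 0 ≤ K) (hb : 4 * K + u < b) (hc : 6 * K + u < c) : False := by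
  have w1 := hf.west
  have w2 := hf.east
  have w3 := hg.west
  have w4 := hg.east
  have w5 := hk.west
  have w6 := hk.east
  have hw : 0 < w := by omega
  have types : ∀ {X Y α : ℤ} {f : ℤ → ℤ → ℤ}, IsSheet w l q (b + c) b K X Y α f →
      α - b - K ≤ f 0 0 ∧ f 0 0 ≤ α + (b + c) + K ∧
      ((-w < X ∨ X + 4 * w ≤ 0) → α - K ≤ f 0 0 ∧ f 0 0 ≤ α + K) ∧
      ((-2 * w < X ∧ X ≤ -w) ∨ (-4 * w < X ∧ X ≤ - 3 * w) ∨ f 0 0 ≤ α + K) := by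
    intro X Y α f hf
    have v1 := hf.west
    have v2 := hf.east
    have t1 := hf.edge 0 0 v1 v2
    have t2 := hf.side 0 0
    have t3 := hf.mid 0 0
    omega
  have tf := types hf
  have tg := types hg
  have tk := types hk
  have f_g := hf.base_lt hg hq hql hl Hfg hfg
  have g_k := hg.base_lt hk hq hql hl Hgk hgk
  have f_k := hf.base_lt hk hq hql hl Hfk (hgk.trans hfg)
  have f_k' := hf.base_lt_of_near hk hq hql hl Hfk (hgk.trans hfg)
  have g_k' := hg.base_lt_of_near hk hq hql hl Hgk hgk
  by_cases c1 : X < X' + 4 * w ∧ X' < X + 4 * w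
  -- Two separations give `2 * (b + c)`. A middle bridge of `f` and a side bridge of `k` compensate
  -- at most `2 * b + c`, leaving `c` up to `6 * K`.
  · by_cases c2 : X' < X'' + 4 * w ∧ X'' < X' + 4 * w
    · have := f_g c1.1 c1.2
      have := g_k c2.1 c2.2
      omega
    -- Here the origin lies in opposite outer strips of `g` and `k`, so both are within `K` of their
    -- bases.
    · by_cases c3 : X < X'' + 4 * w ∧ X'' < X + 4 * w
      · have := f_k c3.1 c3.2
        omega
      · have := f_g c1.1 c1.2
        omega
  -- Now `f` and `g` have the origin in opposite outer strips. The sheet `k` overlaps at least one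
  -- of them enough to have a much lower base, yet its cell is within `u` below theirs; so the
  -- origin lies on a side strip of `k`.
  · have hlow : γ + K < k 0 0 := by
      by_cases c3 : X < X'' + 4 * w ∧ X'' < X + 4 * w
      · have := f_k c3.1 c3.2
        omega
      · have := g_k (by omega) (by omega)
        omega
    -- A side strip is close to one of the two ends, so `k` is offset by less than `2 * w` from `f`
    -- or from `g`. The stronger separation leaves a distance of `b` up to `4 * K`.
    by_cases c4 : X < X'' + 2 * w ∧ X'' < X + 2 * w
    · have := f_k' c4.1 c4.2
      omega
    · have := g_k' (by omega) (by omega)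
      omega

end Sheets

/-! ## Patches -/

/-- The cell of the cube at `(i', j')` when the surface of `τ^n` of the flat tile is translated so
that the cube at `(i, j)` is in the cell `p`. -/
def patchCell (a b c d n i j : ℕ) (p : ℤ × ℤ × ℤ) (i' j' : ℕ) : ℤ × ℤ × ℤ :=
  (p.1 + i' - i, p.2.1 + j' - j,
    p.2.2 + cubeHeight a b c d n flatTile i' j' - cubeHeight a b c d n flatTile i j)

/-- `z` contains a block of level `m` of the surface through the cell `p`, together with its
southern and northern neighbours. -/
def PatchAt (a b c d m : ℕ) (p : ℤ × ℤ × ℤ) (z : ℤ × ℤ × ℤ → Cube) : Prop :=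
  ∃ n i j : ℕ, len a b c d ^ m ≤ j ∧ ∀ i' j' : ℕ, i' / 5 ^ m = i / 5 ^ m →
    j' / len a b c d ^ m ≤ j / len a b c d ^ m + 1 →
    j / len a b c d ^ m ≤ j' / len a b c d ^ m + 1 →
    z (patchCell a b c d (m + n) i j p i' j') ≠ 0

section Patches

variable {a b c d : ℕ}

theorem abs_height_sub_le (n : ℕ) (t : Tile) (i : ℕ) {j j' : ℕ} (h1 : j' ≤ j + 1)
    (h2 : j ≤ j' + 1) : |height a b c d n t i j' - height a b c d n t i j| ≤ 1 := by
  obtain rfl | rfl | rfl : j' = j ∨ j' = j + 1 ∨ j = j' + 1 := by omega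
  · simp
  · rw [height_succ_right, add_sub_cancel_left]
    exact abs_rise_le _
  · rw [height_succ_right, abs_sub_comm, add_sub_cancel_left]
    exact abs_rise_le _

/-- The reference height is that of block row `J`, while the cell may be in an adjacent block row;
that base differs by at most one coarse unit, hence the term `2 * a * (2 * a) ^ k`. The other error
comes from inside the blocks of level `k`. -/
theorem cubeHeight_block_bounds (hL : 0 < len a b c d) (k n : ℕ) (t : Tile) (i j J : ℕ) (lo hi : ℤ)
    (h1 : j / len a b c d ^ (k + 1) ≤ J + 1) (h2 : J ≤ j / len a b c d ^ (k + 1) + 1)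
    (h : ∀ (T : Tile) (r : ℕ), (r = j % len a b c d ^ (k + 1) / len a b c d ^ k ∨
      r = j % len a b c d ^ (k + 1) / len a b c d ^ k + 1) →
      lo ≤ height a b c d 1 T (i % 5 ^ (k + 1) / 5 ^ k) r ∧
        height a b c d 1 T (i % 5 ^ (k + 1) / 5 ^ k) r ≤ hi) :
    lo * (2 * a) ^ k - (2 * a * (2 * a) ^ k + deviation a b c k) ≤
        cubeHeight a b c d (k + 1 + n) t i j -
          height a b c d n t (i / 5 ^ (k + 1)) J * (2 * a) ^ (k + 1) ∧
      cubeHeight a b c d (k + 1 + n) t i j -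
          height a b c d n t (i / 5 ^ (k + 1)) J * (2 * a) ^ (k + 1) ≤
        hi * (2 * a) ^ k + (2 * a * (2 * a) ^ k + deviation a b c k) := by
  rw [cubeHeight_add hL]
  have h3 := abs_le.1 (abs_height_sub_le (a := a) (b := b) (c := c) (d := d) n t
    (i / 5 ^ (k + 1)) h1 h2)
  obtain ⟨h4, h5⟩ := cubeHeight_succ_bounds (b := b) (c := c) hL k
    (macrotile a b c d n t (i / 5 ^ (k + 1)) (j / len a b c d ^ (k + 1))) (i % 5 ^ (k + 1))
    (j % len a b c d ^ (k + 1)) lo hi (h _ _ (Or.inl rfl)) (h _ _ (Or.inr rfl))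
  have hu : (0 : ℤ) ≤ (2 * a) ^ (k + 1) := by positivity
  have h6 := mul_le_mul_of_nonneg_right h3.1 hu
  have h7 := mul_le_mul_of_nonneg_right h3.2 hu
  rw [pow_succ (2 * a : ℤ)] at h6 h7 ⊢
  constructor <;> linarith

theorem toNat_add_div_mod {i m : ℕ} {x : ℤ} (h1 : -((i % m : ℕ) : ℤ) ≤ x)
    (h2 : x < -((i % m : ℕ) : ℤ) + m) :
    (i + x).toNat / m = i / m ∧ (((i + x).toNat % m : ℕ) : ℤ) = x + (i % m : ℕ) := by
  have h3 := Nat.div_add_mod i m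
  have h4 : (i + x).toNat = m * (i / m) + (x + (i % m : ℕ)).toNat := by
    zify
    rw [Int.toNat_of_nonneg (by omega), Int.toNat_of_nonneg (by omega)]
    zify at h3
    linarith
  have h5 : (x + (i % m : ℕ)).toNat < m := by omega
  rw [h4, Nat.mul_add_div (by omega), Nat.mul_add_mod, Nat.div_eq_of_lt h5, Nat.mod_eq_of_lt h5]
  exact ⟨rfl, by omega⟩

/-- The error has three sources: `2 * a` units of `(2 * a) ^ k` from the plain rows, `2 * a` more
from passing to a neighbouring block, and `deviation` from the finer levels. The bound on `j` keeps
the southern neighbour at natural coordinates. No upper bounds are needed, because `macrotile`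
repeats periodically beyond its range. -/
theorem isSheet_cubeHeight (ha : 0 < a) (k n i j : ℕ) (v : ℤ) (hj : len a b c d ^ (k + 1) ≤ j) :
    IsSheet (5 ^ k) (len a b c d ^ (k + 1)) ((a + b + c) * len a b c d ^ k)
      (b * (2 * a) ^ k + c * (2 * a) ^ k) (b * (2 * a) ^ k)
      (4 * a * (2 * a) ^ k + deviation a b c k)
      (-(i % 5 ^ (k + 1) : ℕ)) (-(j % len a b c d ^ (k + 1) : ℕ))
      (v - cubeHeight a b c d (k + 1 + n) flatTile i j +
        height a b c d n flatTile (i / 5 ^ (k + 1)) (j / len a b c d ^ (k + 1)) *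
          (2 * a) ^ (k + 1))
      (fun x y => v + cubeHeight a b c d (k + 1 + n) flatTile (i + x).toNat (j + y).toNat -
        cubeHeight a b c d (k + 1 + n) flatTile i j) := by
  have hL : 0 < len a b c d := by unfold len; omega
  have hl : 0 < len a b c d ^ (k + 1) := pow_pos hL _
  have hw : (5 : ℤ) * 5 ^ k = ((5 ^ (k + 1) : ℕ) : ℤ) := by push_cast; ring
  have hlc : (len a b c d : ℤ) ^ (k + 1) = ((len a b c d ^ (k + 1) : ℕ) : ℤ) := by push_cast; rfl
  have col : ∀ x : ℤ, -((i % 5 ^ (k + 1) : ℕ) : ℤ) ≤ x →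
      x < -((i % 5 ^ (k + 1) : ℕ) : ℤ) + 5 * 5 ^ k →
      (i + x).toNat / 5 ^ (k + 1) = i / 5 ^ (k + 1) := fun x h1 h2 =>
    (toNat_add_div_mod h1 (by rw [← hw]; exact h2)).1
  have colmod : ∀ (x : ℤ) (r : ℕ), r < 5 → -((i % 5 ^ (k + 1) : ℕ) : ℤ) + r * 5 ^ k ≤ x →
      x < -((i % 5 ^ (k + 1) : ℕ) : ℤ) + (r + 1) * 5 ^ k →
      (i + x).toNat % 5 ^ (k + 1) / 5 ^ k = r ∧
      (i + x).toNat / 5 ^ (k + 1) = i / 5 ^ (k + 1) := by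
    intro x r hr h1 h2
    have h5 : (0 : ℤ) < 5 ^ k := by positivity
    have hr' : (r : ℤ) + 1 ≤ 5 := by exact_mod_cast hr
    have h3 : -((i % 5 ^ (k + 1) : ℕ) : ℤ) ≤ x := by nlinarith
    have h4 : x < -((i % 5 ^ (k + 1) : ℕ) : ℤ) + 5 * 5 ^ k := by nlinarith
    refine ⟨Nat.div_eq_of_lt_le ?_ ?_, col x h3 h4⟩ <;>
    · zify
      have := (toNat_add_div_mod h3 (by rw [← hw]; exact h4)).2
      push_cast at this h1 h2 ⊢
      rw [this]
      linarith
  have side : ∀ x : ℤ, (-((i % 5 ^ (k + 1) : ℕ) : ℤ) + 5 ^ k ≤ x ∧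
      x < -((i % 5 ^ (k + 1) : ℕ) : ℤ) + 2 * 5 ^ k ∨
      -((i % 5 ^ (k + 1) : ℕ) : ℤ) + 3 * 5 ^ k ≤ x ∧
      x < -((i % 5 ^ (k + 1) : ℕ) : ℤ) + 4 * 5 ^ k) → ∃ r : ℕ, (r = 1 ∨ r = 3) ∧
        (i + x).toNat % 5 ^ (k + 1) / 5 ^ k = r ∧
        (i + x).toNat / 5 ^ (k + 1) = i / 5 ^ (k + 1) := by
    rintro x (h | h)
    · exact ⟨1, Or.inl rfl, colmod x 1 (by norm_num) (by simp only [Nat.cast_one]; linarith)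
        (by simp only [Nat.cast_one]; linarith)⟩
    · exact ⟨3, Or.inr rfl, colmod x 3 (by norm_num) (by simp only [Nat.cast_ofNat]; linarith)
        (by simp only [Nat.cast_ofNat]; linarith)⟩
  have row : ∀ y : ℤ, -(len a b c d : ℤ) ^ (k + 1) ≤ y → y < (len a b c d : ℤ) ^ (k + 1) →
      (j + y).toNat / len a b c d ^ (k + 1) ≤ j / len a b c d ^ (k + 1) + 1 ∧
      j / len a b c d ^ (k + 1) ≤ (j + y).toNat / len a b c d ^ (k + 1) + 1 := by
    intro y h1 h2
    rw [hlc] at h1 h2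
    rw [← Nat.add_div_right _ hl, ← Nat.add_div_right _ hl]
    exact ⟨Nat.div_le_div_right (by omega), Nat.div_le_div_right (by omega)⟩
  have lvl : ∀ (y : ℤ) (r : ℕ), (r = (j + y).toNat % len a b c d ^ (k + 1) / len a b c d ^ k ∨
      r = (j + y).toNat % len a b c d ^ (k + 1) / len a b c d ^ k + 1) → r ≤ len a b c d := by
    intro y r hr
    have h1 := Nat.mod_lt (j + y).toNat hl
    rw [pow_succ] at h1
    have := Nat.div_lt_of_lt_mul h1
    rw [← pow_succ] at this
    omega
  have plateau : ∀ (y s : ℤ) (r : ℕ),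
      -((j % len a b c d ^ (k + 1) : ℕ) : ℤ) + s * (len a b c d : ℤ) ^ (k + 1) +
        (a + b + c) * (len a b c d : ℤ) ^ k ≤ y →
      y < -((j % len a b c d ^ (k + 1) : ℕ) : ℤ) + (s + 1) * (len a b c d : ℤ) ^ (k + 1) -
        (a + b + c) * (len a b c d : ℤ) ^ k →
      -(len a b c d : ℤ) ^ (k + 1) ≤ y →
      (r = (j + y).toNat % len a b c d ^ (k + 1) / len a b c d ^ k ∨
      r = (j + y).toNat % len a b c d ^ (k + 1) / len a b c d ^ k + 1) →
      a + b + c ≤ r ∧ r ≤ a + b + c + d := by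
    intro y s r h1 h2 h3 hr
    have e1 : (((j + y).toNat : ℕ) : ℤ) = j + y := Int.toNat_of_nonneg (by rw [hlc] at h3; omega)
    have e2 := Nat.div_add_mod j (len a b c d ^ (k + 1))
    have hq : (0 : ℤ) ≤ (a + b + c) * (len a b c d : ℤ) ^ k := by positivity
    have e3 : (((j + y).toNat % len a b c d ^ (k + 1) : ℕ) : ℤ) =
        y + (j % len a b c d ^ (k + 1) : ℕ) - s * (len a b c d : ℤ) ^ (k + 1) := by
      rw [Int.natCast_mod, e1]
      rw [hlc] at h1 h2 ⊢
      have e4 : (j : ℤ) + y = (y + (j % len a b c d ^ (k + 1) : ℕ) -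
          s * ((len a b c d ^ (k + 1) : ℕ) : ℤ)) + ((len a b c d ^ (k + 1) : ℕ) : ℤ) *
            (((j / len a b c d ^ (k + 1) : ℕ) : ℤ) + s) := by
        zify at e2
        push_cast
        linarith
      rw [e4, Int.add_mul_emod_self_left, Int.emod_eq_of_lt] <;> linarith
    have e5 : (a + b + c) ≤ (j + y).toNat % len a b c d ^ (k + 1) / len a b c d ^ k := by
      rw [Nat.le_div_iff_mul_le (pow_pos hL k)]
      zify
      push_cast at e3 h1 ⊢
      rw [e3]
      linarith
    -- The inequality is strict so that the next coarse row, the north edge of the tile, is still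
    -- within the plateau.
    have e6 : (j + y).toNat % len a b c d ^ (k + 1) / len a b c d ^ k < a + b + c + d := by
      rw [Nat.div_lt_iff_lt_mul (pow_pos hL k)]
      zify
      push_cast at e3 h2 ⊢
      rw [e3]
      have e7 : (len a b c d : ℤ) ^ (k + 1) =
        (len a b c d : ℤ) ^ k * (2 * (a + b + c) + d) := by
        rw [pow_succ]
        congr 1
      rw [e7] at h2 ⊢
      linarith
    omega
  have hi0 : (0 : ℤ) ≤ (i % 5 ^ (k + 1) : ℕ) := Int.natCast_nonneg _
  have hj0 : (0 : ℤ) ≤ (j % len a b c d ^ (k + 1) : ℕ) := Int.natCast_nonneg _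
  have hi5 : ((i % 5 ^ (k + 1) : ℕ) : ℤ) < (5 ^ (k + 1) : ℕ) := by
    exact_mod_cast Nat.mod_lt i (pow_pos (show 0 < 5 by norm_num) (k + 1))
  have hjl : ((j % len a b c d ^ (k + 1) : ℕ) : ℤ) < (len a b c d ^ (k + 1) : ℕ) := by
    exact_mod_cast Nat.mod_lt j hl
  refine ⟨by linarith, by rw [hw]; linarith, by linarith, by rw [hlc]; linarith, ?_, ?_, ?_, ?_, ?_,
    ?_, ?_⟩
  · intro x y _ _ hy _
    rw [hlc] at hy
    have := abs_cubeHeight_succ_sub_le a b c d (k + 1 + n) flatTile (i + x).toNat (j + y).toNat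
    rw [show (j + (y + 1)).toNat = (j + y).toNat + 1 by omega]
    rw [abs_le] at this ⊢
    omega
  · intro x x' h1 h2 h3 h4
    -- Removing the remainder leads to the south border of the block, where all cubes are level by
    -- `cubeHeight_zero_right`.
    have e : (j + -((j % len a b c d ^ (k + 1) : ℕ) : ℤ)).toNat =
        len a b c d ^ (k + 1) * (j / len a b c d ^ (k + 1)) := by
      have := Nat.div_add_mod j (len a b c d ^ (k + 1))
      generalize j % len a b c d ^ (k + 1) = r at *
      generalize len a b c d ^ (k + 1) * (j / len a b c d ^ (k + 1)) = m at *
      omega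
    simp only [e]
    rw [cubeHeight_add hL, cubeHeight_add hL _ _ _ (i + x').toNat, col x h1 h2, col x' h3 h4,
      Nat.mul_mod_right, cubeHeight_zero_right ha, cubeHeight_zero_right ha]
  · intro x y h1 h2 h3 h4 h5
    obtain ⟨r, hr, h6, h7⟩ : ∃ r : ℕ, (r = 0 ∨ r = 4) ∧
        (i + x).toNat % 5 ^ (k + 1) / 5 ^ k = r ∧
        (i + x).toNat / 5 ^ (k + 1) = i / 5 ^ (k + 1) := by
      rcases h3 with h3 | h3
      · exact ⟨0, Or.inl rfl, colmod x 0 (by norm_num) (by simpa using h1) (by simpa using h3)⟩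
      · exact ⟨4, Or.inr rfl, colmod x 4 (by norm_num) h3 (by simp only [Nat.cast_ofNat]; linarith)⟩
    have B := cubeHeight_block_bounds (b := b) (c := c) hL k n flatTile (i + x).toNat (j + y).toNat
      _ (-(2 * a)) (2 * a) (row y h4 h5).1 (row y h4 h5).2
      fun T m hm => by rw [h6]; exact height_one_edge T hr (lvl y m hm)
    rw [h7] at B
    constructor <;> linarith
  · intro x y h3 h4 h5
    obtain ⟨r, hr, h6, h7⟩ := side x h3
    have B := cubeHeight_block_bounds (b := b) (c := c) hL k n flatTile (i + x).toNat (j + y).toNat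
      _ (-(2 * a)) (2 * a + (b + c)) (row y h4 h5).1 (row y h4 h5).2
      fun T m hm => by rw [h6]; exact height_one_side T hr (lvl y m hm)
    rw [h7] at B
    constructor <;> linarith
  · intro x y h2 h3 h4 h5
    obtain ⟨h6, h7⟩ := colmod x 2 (by norm_num) h2 (by simp only [Nat.cast_ofNat]; linarith)
    have B := cubeHeight_block_bounds (b := b) (c := c) hL k n flatTile (i + x).toNat (j + y).toNat
      _ (-(2 * a + b)) (2 * a) (row y h4 h5).1 (row y h4 h5).2
      fun T m hm => by rw [h6]; exact height_one_mid T (lvl y m hm)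
    rw [h7] at B
    constructor <;> linarith
  · intro x y s h3 h4 h5 h8 h9
    obtain ⟨r, hr, h6, h7⟩ := side x h3
    have B := cubeHeight_block_bounds (b := b) (c := c) hL k n flatTile (i + x).toNat (j + y).toNat
      _ (b + c - 2 * a) (2 * a + (b + c)) (row y h4 h5).1 (row y h4 h5).2
      fun T m hm => by
        rw [h6]
        have h10 := plateau y s m h8 h9 h4 hm
        exact ⟨height_one_side_plateau T hr h10.1 h10.2, (height_one_side T hr (lvl y m hm)).2⟩
    rw [h7] at B
    linarith
  · intro x y s h2 h3 h4 h5 h8 h9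
    obtain ⟨h6, h7⟩ := colmod x 2 (by norm_num) h2 (by simp only [Nat.cast_ofNat]; linarith)
    have B := cubeHeight_block_bounds (b := b) (c := c) hL k n flatTile (i + x).toNat (j + y).toNat
      _ (-(2 * a + b)) (2 * a - b) (row y h4 h5).1 (row y h4 h5).2
      fun T m hm => by
        rw [h6]
        have h10 := plateau y s m h8 h9 h4 hm
        exact ⟨(height_one_mid T (lvl y m hm)).1, height_one_mid_plateau T h10.1 h10.2⟩
    rw [h7] at B
    linarith

end Patches

/-! ### Connectedness and closedness of patches -/

section Patches

variable {a b c d : ℕ}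

theorem abs_cubeHeight_sub_le_abs (n : ℕ) (t : Tile) (i j j' : ℕ) :
    |cubeHeight a b c d n t i j' - cubeHeight a b c d n t i j| ≤ |(j' : ℤ) - j| := by
  rcases le_total j j' with h | h
  · obtain ⟨k, rfl⟩ := Nat.exists_eq_add_of_le h
    simpa using abs_cubeHeight_sub_le a b c d n t i j k
  · obtain ⟨k, rfl⟩ := Nat.exists_eq_add_of_le h
    rw [abs_sub_comm]
    simpa using abs_cubeHeight_sub_le a b c d n t i j' k

/-- The cubes on the south border of a row of a block lie on the same level. -/
theorem cubeHeight_base (ha : 0 < a) (m n : ℕ) (t : Tile) {i i' : ℕ} (J : ℕ)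
    (h : i' / 5 ^ m = i / 5 ^ m) :
    cubeHeight a b c d (m + n) t i' (len a b c d ^ m * J) =
      cubeHeight a b c d (m + n) t i (len a b c d ^ m * J) := by
  have hL : 0 < len a b c d := by unfold len; omega
  rw [cubeHeight_add hL, cubeHeight_add hL _ _ _ i, h, Nat.mul_mod_right, cubeHeight_zero_right ha,
    cubeHeight_zero_right ha]

theorem patchCell_self (n i j : ℕ) (p : ℤ × ℤ × ℤ) : patchCell a b c d n i j p i j = p := by
  simp [patchCell]

theorem adj_patchCell_north {z : ℤ × ℤ × ℤ → Cube} {n i j : ℕ} {p : ℤ × ℤ × ℤ} {i' j' : ℕ}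
    (h1 : z (patchCell a b c d n i j p i' j') ≠ 0)
    (h2 : z (patchCell a b c d n i j p i' (j' + 1)) ≠ 0) :
    (sightGraph 1 z).Adj (patchCell a b c d n i j p i' j')
      (patchCell a b c d n i j p i' (j' + 1)) := by
  refine ⟨fun h => ?_, h1, h2, (dist_le_one_iff _ _).2 ?_⟩
  · have := congrArg (fun v : ℤ × ℤ × ℤ => v.2.1) h
    simp [patchCell] at this
  · have := abs_cubeHeight_succ_sub_le a b c d n flatTile i' j'
    simp only [patchCell]
    rw [abs_le] at *
    push_cast
    refine ⟨by simp, by rw [abs_le]; omega, by rw [abs_le]; omega⟩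

/-- Columns are connected from south to north across the three blocks, and the level south border of
the central block, available since `a > 0`, links the columns together. Jagged edges thus never
disconnect a patch. -/
theorem reachable_patchCell (ha : 0 < a) {z : ℤ × ℤ × ℤ → Cube} {m n i j : ℕ} {p : ℤ × ℤ × ℤ}
    (h : ∀ i' j' : ℕ, i' / 5 ^ m = i / 5 ^ m →
      j' / len a b c d ^ m ≤ j / len a b c d ^ m + 1 →
      j / len a b c d ^ m ≤ j' / len a b c d ^ m + 1 →
      z (patchCell a b c d (m + n) i j p i' j') ≠ 0)
    {i' j' : ℕ} (h1 : i' / 5 ^ m = i / 5 ^ m) (h2 : j' / len a b c d ^ m ≤ j / len a b c d ^ m + 1)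
    (h3 : j / len a b c d ^ m ≤ j' / len a b c d ^ m + 1) :
    (sightGraph 1 z).Reachable p (patchCell a b c d (m + n) i j p i' j') := by
  have hL : 0 < len a b c d := by unfold len; omega
  have hl : 0 < len a b c d ^ m := pow_pos hL m
  have h5 : 0 < 5 ^ m := by positivity
  have north : ∀ i₁ j₁ k : ℕ, i₁ / 5 ^ m = i / 5 ^ m → j / len a b c d ^ m ≤ j₁ / len a b c d ^ m + 1 →
      (j₁ + k) / len a b c d ^ m ≤ j / len a b c d ^ m + 1 →
      (sightGraph 1 z).Reachable (patchCell a b c d (m + n) i j p i₁ j₁)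
        (patchCell a b c d (m + n) i j p i₁ (j₁ + k)) := by
    intro i₁ j₁ k e1 e2
    induction k with
    | zero => intro _; rfl
    | succ k ih =>
      intro e3
      have e4 : (j₁ + k) / len a b c d ^ m ≤ (j₁ + (k + 1)) / len a b c d ^ m :=
        Nat.div_le_div_right (by omega)
      have e5 : j₁ / len a b c d ^ m ≤ (j₁ + k) / len a b c d ^ m :=
        Nat.div_le_div_right (by omega)
      exact (ih (by omega)).trans (adj_patchCell_north
        (h i₁ (j₁ + k) e1 (by omega) (by omega))
        (h i₁ (j₁ + (k + 1)) e1 e3 (by omega))).reachable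
  have column : ∀ i₁ j₁ j₂ : ℕ, i₁ / 5 ^ m = i / 5 ^ m →
      j₁ / len a b c d ^ m ≤ j / len a b c d ^ m + 1 →
      j / len a b c d ^ m ≤ j₁ / len a b c d ^ m + 1 →
      j₂ / len a b c d ^ m ≤ j / len a b c d ^ m + 1 →
      j / len a b c d ^ m ≤ j₂ / len a b c d ^ m + 1 →
      (sightGraph 1 z).Reachable (patchCell a b c d (m + n) i j p i₁ j₁)
        (patchCell a b c d (m + n) i j p i₁ j₂) := by
    intro i₁ j₁ j₂ e1 e2 e3 e4 e5
    rcases le_total j₁ j₂ with e | e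
    · obtain ⟨k, rfl⟩ := Nat.exists_eq_add_of_le e
      exact north i₁ j₁ k e1 e3 e4
    · obtain ⟨k, rfl⟩ := Nat.exists_eq_add_of_le e
      exact (north i₁ j₂ k e1 e5 e2).symm
  have hJ : len a b c d ^ m * (j / len a b c d ^ m) / len a b c d ^ m = j / len a b c d ^ m :=
    Nat.mul_div_cancel_left _ hl
  have row : ∀ r : ℕ, r < 5 ^ m → (sightGraph 1 z).Reachable
      (patchCell a b c d (m + n) i j p (5 ^ m * (i / 5 ^ m)) (len a b c d ^ m * (j / len a b c d ^ m)))
      (patchCell a b c d (m + n) i j p (5 ^ m * (i / 5 ^ m) + r)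
        (len a b c d ^ m * (j / len a b c d ^ m))) := by
    intro r
    induction r with
    | zero => intro _; rfl
    | succ r ih =>
      intro hr
      have e1 : (5 ^ m * (i / 5 ^ m) + r) / 5 ^ m = i / 5 ^ m := by
        rw [Nat.mul_add_div h5, Nat.div_eq_of_lt (show r < 5 ^ m by omega), add_zero]
      have e2 : (5 ^ m * (i / 5 ^ m) + (r + 1)) / 5 ^ m = i / 5 ^ m := by
        rw [Nat.mul_add_div h5, Nat.div_eq_of_lt hr, add_zero]
      refine (ih (by omega)).trans (SimpleGraph.Adj.reachable ⟨fun h => ?_,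
        h _ _ e1 (by omega) (by omega), h _ _ e2 (by omega) (by omega),
        (dist_le_one_iff _ _).2 ?_⟩)
      · have := congrArg (fun v : ℤ × ℤ × ℤ => v.1) h
        simp only [patchCell] at this
        push_cast at this
        omega
      · simp only [patchCell]
        rw [cubeHeight_base ha m n flatTile _ (e2.trans e1.symm)]
        refine ⟨by rw [abs_le]; push_cast; omega, by simp, by simp⟩
  have base : ∀ i₁ j₁ : ℕ, i₁ / 5 ^ m = i / 5 ^ m → j₁ / len a b c d ^ m ≤ j / len a b c d ^ m + 1 →
      j / len a b c d ^ m ≤ j₁ / len a b c d ^ m + 1 → (sightGraph 1 z).Reachable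
      (patchCell a b c d (m + n) i j p (5 ^ m * (i / 5 ^ m)) (len a b c d ^ m * (j / len a b c d ^ m)))
      (patchCell a b c d (m + n) i j p i₁ j₁) := by
    intro i₁ j₁ e1 e2 e3
    have e4 := row (i₁ % 5 ^ m) (Nat.mod_lt _ h5)
    rw [← e1, Nat.div_add_mod, e1] at e4
    exact e4.trans (column i₁ _ j₁ e1 (by omega) (by omega) e2 e3)
  have e := (base i j rfl (by omega) (by omega)).symm.trans (base i' j' h1 h2 h3)
  rwa [patchCell_self] at e

/-- A patch is connected to its cell, so it survives in the component of that cell. -/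
theorem PatchAt.componentConfig (ha : 0 < a) {m : ℕ} {z : ℤ × ℤ × ℤ → Cube} {p u : ℤ × ℤ × ℤ}
    (h : PatchAt a b c d m p z) (hup : (sightGraph 1 z).Reachable u p) :
    PatchAt a b c d m p (componentConfig 1 z u) := by
  obtain ⟨n, i, j, hj, h⟩ := h
  exact ⟨n, i, j, hj, fun i' j' h1 h2 h3 => componentConfig_ne_zero.2
    ⟨hup.trans (reachable_patchCell ha h h1 h2 h3), h i' j' h1 h2 h3⟩⟩

theorem PatchAt.mono {m : ℕ} {z z' : ℤ × ℤ × ℤ → Cube} {p : ℤ × ℤ × ℤ}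
    (h : PatchAt a b c d m p z) (hz : ∀ q, z q ≠ 0 → z' q ≠ 0) : PatchAt a b c d m p z' := by
  obtain ⟨n, i, j, hj, h⟩ := h
  exact ⟨n, i, j, hj, fun i' j' h1 h2 h3 => hz _ (h i' j' h1 h2 h3)⟩

theorem PatchAt.shift {m : ℕ} {z : ℤ × ℤ × ℤ → Cube} {p g : ℤ × ℤ × ℤ}
    (h : PatchAt a b c d m (-g + p) z) : PatchAt a b c d m p (shift g z) := by
  obtain ⟨n, i, j, hj, h⟩ := h
  refine ⟨n, i, j, hj, fun i' j' h1 h2 h3 => ?_⟩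
  have := h i' j' h1 h2 h3
  simp only [SparseSubshift.shift]
  convert this using 2
  simp only [patchCell, Prod.ext_iff, Prod.fst_add, Prod.snd_add, Prod.fst_neg, Prod.snd_neg]
  refine ⟨by ring, by ring, by ring⟩

theorem abs_sub_le_of_div_eq {m i i' : ℕ} (hm : 0 < m) (h : i' / m = i / m) :
    |(i' : ℤ) - i| ≤ m := by
  have h1 := Nat.div_add_mod i m
  have h2 := Nat.div_add_mod i' m
  have h3 := Nat.mod_lt i hm
  have h4 := Nat.mod_lt i' hm
  rw [h] at h2
  generalize m * (i / m) = q at *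
  rw [abs_le]
  omega

theorem abs_sub_le_of_div_le {m j j' : ℕ} (hm : 0 < m) (h : j' / m ≤ j / m + 1)
    (h' : j / m ≤ j' / m + 1) : |(j' : ℤ) - j| ≤ 2 * m := by
  have h1 := Nat.div_add_mod j m
  have h2 := Nat.div_add_mod j' m
  have h3 := Nat.mod_lt j hm
  have h4 := Nat.mod_lt j' hm
  have h5 := Nat.mul_le_mul_left m h
  have h6 := Nat.mul_le_mul_left m h'
  rw [mul_add, mul_one] at h5 h6
  generalize m * (j / m) = q at *
  generalize m * (j' / m) = q' at *
  rw [abs_le]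
  omega

/-- A box around the cell `p` that contains every patch of level `m` at `p`. -/
def patchBox (a b c d m : ℕ) (p : ℤ × ℤ × ℤ) : Set (ℤ × ℤ × ℤ) :=
  Set.Icc (p.1 - 5 ^ m) (p.1 + 5 ^ m) ×ˢ
    Set.Icc (p.2.1 - 2 * len a b c d ^ m) (p.2.1 + 2 * len a b c d ^ m) ×ˢ
    Set.Icc (p.2.2 - 4 * len a b c d ^ m) (p.2.2 + 4 * len a b c d ^ m)

theorem finite_patchBox (m : ℕ) (p : ℤ × ℤ × ℤ) : (patchBox a b c d m p).Finite :=
  (Set.finite_Icc _ _).prod ((Set.finite_Icc _ _).prod (Set.finite_Icc _ _))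

theorem patchCell_mem_patchBox (ha : 0 < a) {m n i j : ℕ} {p : ℤ × ℤ × ℤ} {i' j' : ℕ}
    (h1 : i' / 5 ^ m = i / 5 ^ m) (h2 : j' / len a b c d ^ m ≤ j / len a b c d ^ m + 1)
    (h3 : j / len a b c d ^ m ≤ j' / len a b c d ^ m + 1) :
    patchCell a b c d (m + n) i j p i' j' ∈ patchBox a b c d m p := by
  have hL : 0 < len a b c d := by unfold len; omega
  have hl : 0 < len a b c d ^ m := pow_pos hL m
  have e1 := abs_sub_le_of_div_eq (show 0 < 5 ^ m by positivity) h1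
  have e2 := abs_sub_le_of_div_le hl h2 h3
  have hJ : len a b c d ^ m * (j / len a b c d ^ m) / len a b c d ^ m = j / len a b c d ^ m :=
    Nat.mul_div_cancel_left _ hl
  -- Heights in different columns are compared through the level base row of the block: two vertical
  -- paths, each of length at most `2 * len a b c d ^ m`, account for the factor 4 in `patchBox`.
  have e3 := abs_sub_le_of_div_le hl (j := len a b c d ^ m * (j / len a b c d ^ m)) (j' := j')
    (by rwa [hJ]) (by rwa [hJ])
  have e4 := abs_sub_le_of_div_le hl (j := len a b c d ^ m * (j / len a b c d ^ m)) (j' := j)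
    (by rw [hJ]; omega) (by rw [hJ]; omega)
  have e5 := (abs_cubeHeight_sub_le_abs (a := a) (b := b) (c := c) (d := d) (m + n) flatTile i'
    (len a b c d ^ m * (j / len a b c d ^ m)) j').trans e3
  have e6 := (abs_cubeHeight_sub_le_abs (a := a) (b := b) (c := c) (d := d) (m + n) flatTile i
    (len a b c d ^ m * (j / len a b c d ^ m)) j).trans e4
  rw [cubeHeight_base ha m n flatTile _ h1] at e5
  simp only [patchBox, patchCell, Set.mem_prod, Set.mem_Icc]
  rw [abs_le] at e1 e2 e5 e6
  push_cast at e1 e2 e5 e6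
  refine ⟨⟨?_, ?_⟩, ⟨?_, ?_⟩, ?_, ?_⟩ <;> linarith

/-- Although `n`, `i`, `j` range over infinitely many values, every candidate patch lies in the same
finite box, so the condition depends on finitely many cells. -/
theorem isClosed_patchAt (ha : 0 < a) (m : ℕ) (p : ℤ × ℤ × ℤ) :
    IsClosed {z | PatchAt a b c d m p z} := by
  refine isClosed_of_finite_support _ _ (finite_patchBox (a := a) (b := b) (c := c) (d := d) m p) ?_
  rintro x y hxy ⟨n, i, j, hj, h⟩
  refine ⟨n, i, j, hj, fun i' j' h1 h2 h3 => ?_⟩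
  rw [← hxy _ (patchCell_mem_patchBox ha h1 h2 h3)]
  exact h i' j' h1 h2 h3

end Patches

/-! ## Configurations that look locally like the surface -/

/-- The configurations whose connected components have at most one nonzero cell in every vertical
column, and that contain a patch of every level through each of their nonzero cells. -/
def patchwork (a b c d : ℕ) : Set (ℤ × ℤ × ℤ → Cube) :=
  {z | (∀ p q, (sightGraph 1 z).Reachable p q → p.1 = q.1 → p.2.1 = q.2.1 → p = q) ∧
    ∀ m p, z p ≠ 0 → PatchAt a b c d m p z}

section Patchwork

variable {a b c d : ℕ}

/-- Each violation is open: either a finite walk joins two cells of a column, or a nonzero cell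
lacks a patch of some level. -/
theorem isClosed_patchwork (ha : 0 < a) : IsClosed (patchwork a b c d) := by
  rw [← isOpen_compl_iff, isOpen_iff_mem_nhds]
  intro z hz
  by_cases h : ∀ m p, z p ≠ 0 → PatchAt a b c d m p z
  · have h' : ¬ ∀ p q, (sightGraph 1 z).Reachable p q → p.1 = q.1 → p.2.1 = q.2.1 → p = q :=
      fun h' => hz ⟨h', h⟩
    push Not at h'
    obtain ⟨p, q, hpq, h1, h2, hne⟩ := h'
    filter_upwards [eventually_reachable hpq] with y hy hyz
    exact hne (hyz.1 p q hy h1 h2)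
  · push Not at h
    obtain ⟨m, p, hp, hm⟩ := h
    filter_upwards [eventually_apply_eq z p,
      (isClosed_patchAt (b := b) (c := c) (d := d) ha m p).isOpen_compl.mem_nhds hm] with y hy hym hyz
    exact hym (hyz.2 m p (by rwa [hy]))

theorem isSubshift_patchwork (ha : 0 < a) : IsSubshift (patchwork a b c d) := by
  refine ⟨isClosed_patchwork ha, fun g z hz => ⟨fun p q h h1 h2 => ?_, fun m p hp => ?_⟩⟩
  · exact add_left_cancel (hz.1 _ _ (reachable_shift h) (by simp [h1]) (by simp [h2]))
  · exact (hz.2 m (-g + p) hp).shift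

/-- Both conditions concern one component at a time: the first through walks, the second because
patches are connected. -/
theorem isZeroGluing_patchwork (ha : 0 < a) : IsZeroGluing 1 (patchwork a b c d) := by
  refine ⟨isSubshift_patchwork ha, fun z => ⟨?_, fun h => ⟨fun p q hpq h1 h2 => ?_, fun m p hp => ?_⟩⟩⟩
  · rintro hz _ ⟨u, hu, rfl⟩
    refine ⟨fun p q h => hz.1 p q (h.mono (sightGraph_componentConfig_le 1 z u)), fun m p hp => ?_⟩
    have hp' := componentConfig_ne_zero.1 hp
    exact (hz.2 m p hp'.2).componentConfig ha hp'.1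
  · by_contra hne
    exact hne ((h _ ⟨p, ne_zero_of_reachable hpq hne, rfl⟩).1 p q
      (reachable_componentConfig (SimpleGraph.Reachable.refl _) hpq) h1 h2)
  · refine ((h _ ⟨p, hp, rfl⟩).2 m p ?_).mono fun q hq => (componentConfig_ne_zero.1 hq).2
    exact componentConfig_ne_zero.2 ⟨SimpleGraph.Reachable.refl _, hp⟩

end Patchwork

/-! ### At most two nonzero cells in a column -/

section Sparse

variable {a b c d : ℕ}

theorem toNat_add_div_le {j l : ℕ} (hl : 0 < l) {y : ℤ} (h1 : -(l : ℤ) ≤ y) (h2 : y < l) :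
    (j + y).toNat / l ≤ j / l + 1 ∧ j / l ≤ (j + y).toNat / l + 1 := by
  rw [← Nat.add_div_right _ hl, ← Nat.add_div_right _ hl]
  exact ⟨Nat.div_le_div_right (by omega), Nat.div_le_div_right (by omega)⟩

/-- Sheets that belong to different components of a configuration are apart. -/
theorem apart_of_mem_patchwork (ha : 0 < a) {z : ℤ × ℤ × ℤ → Cube} (hz : z ∈ patchwork a b c d)
    {m n i j n' i' j' : ℕ} {v v' : ℤ} (hv : v ≠ v')
    (hj : len a b c d ^ (m + 1) ≤ j) (hj' : len a b c d ^ (m + 1) ≤ j')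
    (h : ∀ i₁ j₁ : ℕ, i₁ / 5 ^ (m + 1) = i / 5 ^ (m + 1) →
      j₁ / len a b c d ^ (m + 1) ≤ j / len a b c d ^ (m + 1) + 1 →
      j / len a b c d ^ (m + 1) ≤ j₁ / len a b c d ^ (m + 1) + 1 →
      z (patchCell a b c d (m + 1 + n) i j (0, 0, v) i₁ j₁) ≠ 0)
    (h' : ∀ i₁ j₁ : ℕ, i₁ / 5 ^ (m + 1) = i' / 5 ^ (m + 1) →
      j₁ / len a b c d ^ (m + 1) ≤ j' / len a b c d ^ (m + 1) + 1 →
      j' / len a b c d ^ (m + 1) ≤ j₁ / len a b c d ^ (m + 1) + 1 →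
      z (patchCell a b c d (m + 1 + n') i' j' (0, 0, v') i₁ j₁) ≠ 0) :
    Apart (5 ^ m) (len a b c d ^ (m + 1)) (-(i % 5 ^ (m + 1) : ℕ)) (-(i' % 5 ^ (m + 1) : ℕ))
      (fun x y => v + cubeHeight a b c d (m + 1 + n) flatTile (i + x).toNat (j + y).toNat -
        cubeHeight a b c d (m + 1 + n) flatTile i j)
      (fun x y => v' + cubeHeight a b c d (m + 1 + n') flatTile (i' + x).toNat (j' + y).toNat -
        cubeHeight a b c d (m + 1 + n') flatTile i' j') := by
  intro x x' y h1 h2 h3 h4 h5 h6 h7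
  have hL : 0 < len a b c d := by unfold len; omega
  have hl : 0 < len a b c d ^ (m + 1) := pow_pos hL _
  have hw : (5 : ℤ) * 5 ^ m = ((5 ^ (m + 1) : ℕ) : ℤ) := by push_cast; ring
  have hlc : (len a b c d : ℤ) ^ (m + 1) = ((len a b c d ^ (m + 1) : ℕ) : ℤ) := by push_cast; rfl
  rw [hw] at h2 h4
  rw [hlc] at h6 h7
  have e1 := (toNat_add_div_mod h1 h2).1
  have e2 := (toNat_add_div_mod h3 h4).1
  have e3 := toNat_add_div_le (j := j) hl h6 h7
  have e4 := toNat_add_div_le (j := j') hl h6 h7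
  have r1 := reachable_patchCell ha h e1 e3.1 e3.2
  have r2 := reachable_patchCell ha h' e2 e4.1 e4.2
  have n1 := h _ _ e1 e3.1 e3.2
  have n2 := h' _ _ e2 e4.1 e4.2
  have m1 : ((i % 5 ^ (m + 1) : ℕ) : ℤ) ≤ i := by exact_mod_cast Nat.mod_le _ _
  have m2 : ((i' % 5 ^ (m + 1) : ℕ) : ℤ) ≤ i' := by exact_mod_cast Nat.mod_le _ _
  by_contra hlt
  dsimp only at hlt
  -- Cells that are too close are equal or adjacent, which merges the two patches into one
  -- component. That component would then contain two distinct cells over the origin.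
  have key : (sightGraph 1 z).Reachable
      (patchCell a b c d (m + 1 + n) i j (0, 0, v) (i + x).toNat (j + y).toNat)
      (patchCell a b c d (m + 1 + n') i' j' (0, 0, v') (i' + x').toNat (j' + y).toNat) := by
    by_cases he : patchCell a b c d (m + 1 + n) i j (0, 0, v) (i + x).toNat (j + y).toNat =
      patchCell a b c d (m + 1 + n') i' j' (0, 0, v') (i' + x').toNat (j' + y).toNat
    · rw [he]
    · refine SimpleGraph.Adj.reachable ⟨he, n1, n2, (dist_le_one_iff _ _).2 ?_⟩
      simp only [patchCell]
      refine ⟨?_, ?_, by omega⟩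
      · rw [Int.toNat_of_nonneg (by linarith), Int.toNat_of_nonneg (by linarith)]
        rwa [show 0 + ((i : ℤ) + x) - i - (0 + (i' + x') - i') = x - x' by ring]
      · rw [Int.toNat_of_nonneg (by omega), Int.toNat_of_nonneg (by omega)]
        rw [show 0 + ((j : ℤ) + y) - j - (0 + (j' + y) - j') = 0 by ring]
        simp
  have := hz.1 _ _ ((r1.trans key).trans r2.symm) rfl rfl
  simp [hv] at this

theorem deviation_nonneg (a b c n : ℕ) : 0 ≤ deviation a b c n := by
  induction n with
  | zero => rfl
  | succ n ih => rw [deviation]; positivity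

/-- After multiplication by `2 * a - 1`, the closed form `deviation_eq` turns both claims into
consequences of the numerical hypothesis, uniformly in `k`. -/
theorem deviation_lt (ha : 0 < a)
    (hbc : ((b : ℝ) + c) / (2 * a - 1) + 1 + 6 * a < min ((b : ℝ) / 7) ((c : ℝ) / 8)) (k : ℕ) :
    4 * (4 * a * (2 * a) ^ k + deviation a b c k) + (2 * a) ^ k < b * (2 * a) ^ k ∧
    6 * (4 * a * (2 * a) ^ k + deviation a b c k) + (2 * a) ^ k < c * (2 * a) ^ k := by
  have ha' : (1 : ℤ) ≤ a := by exact_mod_cast ha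
  have hs : (0 : ℝ) < 2 * a - 1 := by
    have : (1 : ℝ) ≤ a := by exact_mod_cast ha
    linarith
  obtain ⟨h1, h2⟩ := lt_min_iff.1 hbc
  have e : ((b : ℝ) + c) / (2 * a - 1) * (2 * a - 1) = b + c := div_mul_cancel₀ _ hs.ne'
  have h1' : 7 * ((b : ℤ) + c + (1 + 6 * a) * (2 * a - 1)) < b * (2 * a - 1) := by
    have := mul_lt_mul_of_pos_right h1 hs
    rw [← @Int.cast_lt ℝ]
    push_cast
    linarith
  have h2' : 8 * ((b : ℤ) + c + (1 + 6 * a) * (2 * a - 1)) < c * (2 * a - 1) := by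
    have := mul_lt_mul_of_pos_right h2 hs
    rw [← @Int.cast_lt ℝ]
    push_cast
    linarith
  have hD := deviation_eq a b c k
  have hu : (0 : ℤ) < (2 * a) ^ k := by positivity
  have hs' : (0 : ℤ) < 2 * a - 1 := by linarith
  generalize ((2 : ℤ) * a) ^ k = u at *
  generalize deviation a b c k = D at *
  have hbc0 : (0 : ℤ) ≤ b + c := by positivity
  have hau : (0 : ℤ) ≤ a * u * (2 * a - 1) := by positivity
  have hu' : (0 : ℤ) ≤ u * (2 * a - 1) := by positivity
  have hbcu : (0 : ℤ) ≤ (b + c) * u := by positivity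
  constructor <;> refine lt_of_mul_lt_mul_left ?_ hs'.le
  · have := mul_lt_mul_of_pos_right h1' hu
    linarith
  · have := mul_lt_mul_of_pos_right h2' hu
    linarith

theorem not_three_of_mem_patchwork (ha : 0 < a)
    (hbc : ((b : ℝ) + c) / (2 * a - 1) + 1 + 6 * a < min ((b : ℝ) / 7) ((c : ℝ) / 8))
    (hd : 4 * (a + b + c) ≤ d) {z : ℤ × ℤ × ℤ → Cube} (hz : z ∈ patchwork a b c d)
    {v₁ v₂ v₃ : ℤ} (h12 : v₂ < v₁) (h23 : v₃ < v₂) (h1 : z (0, 0, v₁) ≠ 0)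
    (h2 : z (0, 0, v₂) ≠ 0) (h3 : z (0, 0, v₃) ≠ 0) : False := by
  have hL : 0 < len a b c d := by unfold len; omega
  -- The scale is chosen so that the distance between the extreme cells is below one coarse unit,
  -- which serves as `u`.
  obtain ⟨k, hk⟩ : ∃ k : ℕ, v₁ - v₃ < (2 * a : ℤ) ^ k :=
    pow_unbounded_of_one_lt _ (by have : (1 : ℤ) ≤ a := by exact_mod_cast ha
                                  linarith)
  obtain ⟨n₁, i₁, j₁, hj₁, p₁⟩ := hz.2 (k + 1) _ h1
  obtain ⟨n₂, i₂, j₂, hj₂, p₂⟩ := hz.2 (k + 1) _ h2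
  obtain ⟨n₃, i₃, j₃, hj₃, p₃⟩ := hz.2 (k + 1) _ h3
  obtain ⟨hb, hc⟩ := deviation_lt ha hbc k
  have hlen : 4 * (((a : ℤ) + b + c) * len a b c d ^ k) < len a b c d ^ (k + 1) := by
    have h4 : 4 * ((a : ℤ) + b + c) < len a b c d := by
      unfold len
      push_cast
      have : 4 * ((a : ℤ) + b + c) ≤ d := by exact_mod_cast hd
      have : (0 : ℤ) < a := by exact_mod_cast ha
      linarith
    have h5 : (0 : ℤ) < (len a b c d : ℤ) ^ k := by positivity
    rw [pow_succ]
    nlinarith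
  refine not_three_sheets (isSheet_cubeHeight ha k n₁ i₁ j₁ v₁ hj₁)
    (isSheet_cubeHeight ha k n₂ i₂ j₂ v₂ hj₂) (isSheet_cubeHeight ha k n₃ i₃ j₃ v₃ hj₃)
    (by positivity) hlen (by positivity)
    (apart_of_mem_patchwork ha hz h12.ne' hj₁ hj₂ p₁ p₂)
    (apart_of_mem_patchwork ha hz h23.ne' hj₂ hj₃ p₂ p₃)
    (apart_of_mem_patchwork ha hz (h23.trans h12).ne' hj₁ hj₃ p₁ p₃)
    (by simpa using h12) (by simpa using h23) (u := (2 * a : ℤ) ^ k) ?_ ?_ hb hc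
  · simp only [add_zero, Int.toNat_natCast]
    linarith
  · have := deviation_nonneg a b c k
    positivity

theorem isSparse_verticalTrace_patchwork (ha : 0 < a)
    (hbc : ((b : ℝ) + c) / (2 * a - 1) + 1 + 6 * a < min ((b : ℝ) / 7) ((c : ℝ) / 8))
    (hd : 4 * (a + b + c) ≤ d) : IsSparse 2 (verticalTrace (patchwork a b c d)) := by
  rintro _ ⟨z, hz, rfl⟩
  by_contra hlt
  obtain ⟨t, ht, ht3⟩ := Set.exists_subset_encard_eq
    (Order.add_one_le_of_lt (not_le.1 hlt) : ((2 : ℕ) : ℕ∞) + 1 ≤ _)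
  obtain ⟨x, y, w, hxy, hxw, hyw, rfl⟩ := Set.encard_eq_three.1 (ht3.trans (by norm_num))
  have hx : z (0, 0, x) ≠ 0 := ht (by simp)
  have hy : z (0, 0, y) ≠ 0 := ht (by simp)
  have hw : z (0, 0, w) ≠ 0 := ht (by simp)
  have key : ∀ {v₁ v₂ v₃ : ℤ}, v₂ < v₁ → v₃ < v₂ → z (0, 0, v₁) ≠ 0 → z (0, 0, v₂) ≠ 0 →
      z (0, 0, v₃) ≠ 0 → False := not_three_of_mem_patchwork ha hbc hd hz
  rcases hxy.lt_or_gt with h1 | h1 <;> rcases hxw.lt_or_gt with h2 | h2 <;>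
    rcases hyw.lt_or_gt with h3 | h3
  · exact key h3 h1 hw hy hx
  · exact key h3 h2 hy hw hx
  · omega
  · exact key h1 h2 hy hx hw
  · exact key h2 h1 hw hx hy
  · omega
  · exact key h2 h3 hx hw hy
  · exact key h1 h3 hx hy hw

end Sparse

/-! ## Convergence -/

section Convergence

variable {a b c d : ℕ}

theorem slope_tau_congr {t t' : Tile} (h : t.slope = t'.slope) (i j : ℕ) :
    (tau a b c d t i j).slope = (tau a b c d t' i j).slope := by
  simp [tau, h]

/-- Jaggedness never influences slopes, so any flat block, with or without jagged edges, carries the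
same cubes as the image of `flatTile`. -/
theorem slope_macrotile_congr {t t' : Tile} (h : t.slope = t'.slope) (n i j : ℕ) :
    (macrotile a b c d n t i j).slope = (macrotile a b c d n t' i j).slope := by
  induction n generalizing i j with
  | zero => exact h
  | succ n ih => exact slope_tau_congr (ih _ _) _ _

theorem cubeHeight_congr {t t' : Tile} (h : t.slope = t'.slope) (n i j : ℕ) :
    cubeHeight a b c d n t i j = cubeHeight a b c d n t' i j := by
  simp [cubeHeight, height, slope_macrotile_congr h]

theorem cubeOf_congr {t t' : Tile} (h : t.slope = t'.slope) : cubeOf t = cubeOf t' := by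
  simp [cubeOf, h]

open Classical in
/-- Near the centre, `x^(m+p)` is determined by flat blocks of level `m`: if the centre and the
column of the cell `v` belong to flat blocks at the same height, then the value at `v` is determined
by the relative positions inside of the blocks. -/
theorem surfaceConfig_eq_of_flat (hL : 0 < len a b c d) (m p I J J' ri₀ rj₀ ri rj : ℕ)
    (v : ℤ × ℤ × ℤ)
    (hI : I < 5 ^ p) (hJ' : J' < len a b c d ^ p)
    (hi₀ : 5 ^ (m + p) / 2 = 5 ^ m * I + ri₀) (hri₀ : ri₀ < 5 ^ m)
    (hj₀ : len a b c d ^ (m + p) / 2 = len a b c d ^ m * J + rj₀) (hrj₀ : rj₀ < len a b c d ^ m)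
    (hi : v.1 + ri₀ = ri) (hri : ri < 5 ^ m)
    (hj : v.2.1 + (len a b c d ^ m * J + rj₀ : ℕ) = (len a b c d ^ m * J' + rj : ℕ))
    (hrj : rj < len a b c d ^ m)
    (hH : height a b c d p flatTile I J = height a b c d p flatTile I J')
    (hs : (macrotile a b c d p flatTile I J).slope = .flat)
    (hs' : (macrotile a b c d p flatTile I J').slope = .flat) :
    surfaceConfig a b c d (m + p) v =
      if v.2.2 = cubeHeight a b c d m flatTile ri rj - cubeHeight a b c d m flatTile ri₀ rj₀ then
        cubeOf (macrotile a b c d m flatTile ri rj) else 0 := by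
  have hl : 0 < len a b c d ^ m := pow_pos hL m
  have h5 : 0 < 5 ^ m := by positivity
  have e1 : v.1 + (5 ^ (m + p) / 2 : ℕ) = (5 ^ m * I + ri : ℕ) := by
    rw [hi₀]
    push_cast
    rw [← hi]
    ring
  have e2 : v.2.1 + (len a b c d ^ (m + p) / 2 : ℕ) = (len a b c d ^ m * J' + rj : ℕ) := by
    rw [hj₀]
    exact hj
  have f1 : 5 ^ m * I + ri < 5 ^ (m + p) := by
    rw [pow_add]
    nlinarith [Nat.mul_le_mul_left (5 ^ m) (Nat.succ_le_of_lt hI)]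
  have f2 : len a b c d ^ m * J' + rj < len a b c d ^ (m + p) := by
    rw [pow_add]
    nlinarith [Nat.mul_le_mul_left (len a b c d ^ m) (Nat.succ_le_of_lt hJ')]
  have g1 : ((5 ^ m * I + ri : ℕ) : ℤ) < 5 ^ (m + p) := by exact_mod_cast f1
  have g2 : ((len a b c d ^ m * J' + rj : ℕ) : ℤ) < (len a b c d : ℤ) ^ (m + p) := by
    exact_mod_cast f2
  have d1 : ∀ x r, r < 5 ^ m → (5 ^ m * x + r) / 5 ^ m = x ∧ (5 ^ m * x + r) % 5 ^ m = r :=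
    fun x r hr => by
      rw [Nat.mul_add_div h5, Nat.mul_add_mod, Nat.div_eq_of_lt hr, Nat.mod_eq_of_lt hr]
      simp
  have d2 : ∀ x r, r < len a b c d ^ m → (len a b c d ^ m * x + r) / len a b c d ^ m = x ∧
      (len a b c d ^ m * x + r) % len a b c d ^ m = r :=
    fun x r hr => by
      rw [Nat.mul_add_div hl, Nat.mul_add_mod, Nat.div_eq_of_lt hr, Nat.mod_eq_of_lt hr]
      simp
  have c1 : cubeHeight a b c d (m + p) flatTile (5 ^ m * I + ri) (len a b c d ^ m * J' + rj) =
      height a b c d p flatTile I J' * (2 * a) ^ m + cubeHeight a b c d m flatTile ri rj := by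
    rw [cubeHeight_add hL, (d1 I ri hri).1, (d1 I ri hri).2, (d2 J' rj hrj).1, (d2 J' rj hrj).2,
      cubeHeight_congr (t' := flatTile) hs']
  have c2 : cubeHeight a b c d (m + p) flatTile (5 ^ m * I + ri₀) (len a b c d ^ m * J + rj₀) =
      height a b c d p flatTile I J' * (2 * a) ^ m + cubeHeight a b c d m flatTile ri₀ rj₀ := by
    rw [cubeHeight_add hL, (d1 I ri₀ hri₀).1, (d1 I ri₀ hri₀).2, (d2 J rj₀ hrj₀).1,
      (d2 J rj₀ hrj₀).2, cubeHeight_congr (t' := flatTile) hs, hH]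
  have c3 : cubeOf (macrotile a b c d (m + p) flatTile (5 ^ m * I + ri)
      (len a b c d ^ m * J' + rj)) = cubeOf (macrotile a b c d m flatTile ri rj) := by
    refine cubeOf_congr ?_
    rw [macrotile_add, (d1 I ri hri).1, (d1 I ri hri).2, (d2 J' rj hrj).1, (d2 J' rj hrj).2]
    exact slope_macrotile_congr hs' _ _ _
  simp only [surfaceConfig]
  rw [e1, e2, Int.toNat_natCast, Int.toNat_natCast, hi₀, hj₀, c1, c2, c3, add_sub_add_left_eq_sub]
  simp only [g1, g2, Int.natCast_nonneg, true_and]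

theorem slope_one_plateau {i j : ℕ} (hi : i = 2) (h1 : a + b + c ≤ j) (h2 : j < a + b + c + d) :
    (macrotile a b c d 1 flatTile i j).slope = .flat := by
  have h3 : j < len a b c d := by unfold len; omega
  subst hi
  simp only [macrotile, tau, flatTile, Nat.mod_eq_of_lt h3]
  unfold plainImage
  rw [if_neg (by omega), if_neg (by omega), if_neg (by omega), if_pos (by omega)]
  rfl

/-- The centre of the larger macrotile is the centre of its central block of level `n`, and that
block is flat because it lies on the plateau. -/
theorem surfaceConfig_succ_of_odd (hodd : len a b c d % 2 = 1) (n : ℕ) (v : ℤ × ℤ × ℤ)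
    (h1 : |v.1| ≤ (5 ^ n / 2 : ℕ)) (h2 : |v.2.1| ≤ (len a b c d ^ n / 2 : ℕ)) :
    surfaceConfig a b c d (n + 1) v = surfaceConfig a b c d n v := by
  have hlen : len a b c d = 2 * (a + b + c) + d := rfl
  have hL : 0 < len a b c d := by omega
  have o1 : 5 ^ n % 2 = 1 := by simp [Nat.pow_mod]
  have o2 : len a b c d ^ n % 2 = 1 := by simp [Nat.pow_mod, hodd]
  have hJ : len a b c d / 2 < len a b c d := by omega
  rw [abs_le] at h1 h2
  have hs : (macrotile a b c d 1 flatTile 2 (len a b c d / 2)).slope = .flat :=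
    slope_one_plateau rfl (by omega) (by omega)
  rw [surfaceConfig_eq_of_flat hL n 1 2 (len a b c d / 2) (len a b c d / 2) (5 ^ n / 2)
      (len a b c d ^ n / 2) (v.1 + (5 ^ n / 2 : ℕ)).toNat
      (v.2.1 + (len a b c d ^ n / 2 : ℕ)).toNat v (by norm_num) (by simpa using hJ)
      (by rw [pow_succ]; omega) (by omega) ?_ (by omega) (by omega) (by omega)
      (by rw [Nat.cast_add, Nat.cast_add]; omega) (by omega) rfl hs hs]
  · have := surfaceConfig_eq_of_flat hL n 0 0 0 0 (5 ^ n / 2)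
      (len a b c d ^ n / 2) (v.1 + (5 ^ n / 2 : ℕ)).toNat
      (v.2.1 + (len a b c d ^ n / 2 : ℕ)).toNat v (by norm_num) (by norm_num)
      (by simp) (by omega) (by simp) (by omega) (by omega) (by omega)
      (by rw [Nat.cast_add, Nat.cast_add]; omega) (by omega) rfl rfl rfl
    exact this.symm
  · rw [pow_succ]
    have e : len a b c d ^ n * len a b c d =
        2 * (len a b c d ^ n * (len a b c d / 2)) + len a b c d ^ n := by
      have e0 := Nat.div_add_mod (len a b c d) 2
      rw [hodd] at e0
      calc len a b c d ^ n * len a b c d =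
          len a b c d ^ n * (2 * (len a b c d / 2) + 1) := by rw [e0]
        _ = _ := by ring
    rw [e]
    omega

/-- For even length, the centre of `x^(m+p)` is on the border of two flat blocks of level `m`. -/
theorem surfaceConfig_eq_of_even (hL : 0 < len a b c d) (m p I J : ℕ)
    (hI : I < 5 ^ p) (hJ : J + 1 < len a b c d ^ p)
    (hi₀ : 5 ^ (m + p) / 2 = 5 ^ m * I + 5 ^ m / 2)
    (hj₀ : len a b c d ^ (m + p) / 2 = len a b c d ^ m * (J + 1))
    (hs : (macrotile a b c d p flatTile I J).slope = .flat)
    (hs' : (macrotile a b c d p flatTile I (J + 1)).slope = .flat) (v : ℤ × ℤ × ℤ)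
    (h1 : |v.1| ≤ (5 ^ m / 2 : ℕ)) (h2 : |v.2.1| < (len a b c d ^ m : ℕ)) :
    surfaceConfig a b c d (m + p) v =
      let ri := (v.1 + (5 ^ m / 2 : ℕ)).toNat
      let rj := if v.2.1 < 0 then (v.2.1 + (len a b c d ^ m : ℕ)).toNat else v.2.1.toNat
      open Classical in
      if v.2.2 = cubeHeight a b c d m flatTile ri rj - cubeHeight a b c d m flatTile (5 ^ m / 2) 0
        then cubeOf (macrotile a b c d m flatTile ri rj) else 0 := by
  have o1 : 5 ^ m % 2 = 1 := by simp [Nat.pow_mod]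
  have hl : 0 < len a b c d ^ m := pow_pos hL m
  rw [abs_le] at h1
  rw [abs_lt] at h2
  have hH : height a b c d p flatTile I (J + 1) = height a b c d p flatTile I J := by
    rw [height_succ_right, hs]
    simp [Slope.rise]
  by_cases hv : v.2.1 < 0
  · simp only [hv, if_true]
    refine surfaceConfig_eq_of_flat hL m p I (J + 1) J (5 ^ m / 2) 0 _ _ v hI (by omega) hi₀
      (by omega) hj₀ hl (by omega) (by omega) ?_ (by omega) hH hs' hs
    rw [mul_add]
    push_cast
    push_cast at h2
    rw [Int.toNat_of_nonneg (by linarith)]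
    ring
  · simp only [hv, if_false]
    refine surfaceConfig_eq_of_flat hL m p I (J + 1) (J + 1) (5 ^ m / 2) 0 _ _ v hI hJ hi₀
      (by omega) hj₀ hl (by omega) (by omega) ?_ (by omega) rfl hs' hs'
    push_cast
    rw [Int.toNat_of_nonneg (by linarith)]
    ring

/-- In both configurations the centre is on the border of two flat blocks of level `m`, one south of
the other. The comparison starts at level `m + 1`, because a single block of level `m` has no such
border at its centre. -/
theorem surfaceConfig_succ_of_even (hd : 4 * (a + b + c) ≤ d) (ha : 0 < a)
    (heven : len a b c d % 2 = 0) (m : ℕ) (v : ℤ × ℤ × ℤ)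
    (h1 : |v.1| ≤ (5 ^ m / 2 : ℕ)) (h2 : |v.2.1| < (len a b c d ^ m : ℕ)) :
    surfaceConfig a b c d (m + 2) v = surfaceConfig a b c d (m + 1) v := by
  have hlen : len a b c d = 2 * (a + b + c) + d := rfl
  have hL : 0 < len a b c d := by omega
  have o1 : 5 ^ m % 2 = 1 := by simp [Nat.pow_mod]
  obtain ⟨M, hM⟩ : ∃ M, len a b c d = 2 * (M + 1) := ⟨len a b c d / 2 - 1, by omega⟩
  have t1 : (macrotile a b c d 1 flatTile 2 M).slope = .flat :=
    slope_one_plateau rfl (by omega) (by omega)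
  have t2 : (macrotile a b c d 1 flatTile 2 (M + 1)).slope = .flat :=
    slope_one_plateau rfl (by omega) (by omega)
  -- The central column at level 2 is `12 = 5 * 2 + 2`. The blocks next to the centre come from the
  -- first row of the image of the northern flat tile and the last row of that of the southern one;
  -- both rows are plain.
  have t4 : (macrotile a b c d 2 flatTile 12 (len a b c d * (M + 1))).slope = .flat := by
    rw [macrotile, Nat.mul_div_cancel_left _ hL, Nat.mul_mod_right]
    simp [tau, plainImage, ha, plainRow, t2]
  obtain ⟨N, hN⟩ : ∃ N, len a b c d * (M + 1) = N + 1 :=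
    Nat.exists_eq_succ_of_ne_zero (by positivity)
  have hN' : N = len a b c d * M + (len a b c d - 1) := by
    rw [mul_add] at hN
    omega
  have t3 : (macrotile a b c d 2 flatTile 12 N).slope = .flat := by
    have e1 : N / len a b c d = M := by
      rw [hN', Nat.mul_add_div hL, Nat.div_eq_of_lt (by omega : len a b c d - 1 < len a b c d),
        add_zero]
    have e2 : N % len a b c d = len a b c d - 1 := by
      rw [hN', Nat.mul_add_mod, Nat.mod_eq_of_lt (by omega)]
    rw [macrotile, e1, e2]
    simp only [tau, t1]
    unfold plainImage
    rw [if_neg (by omega), if_neg (by omega), if_neg (by omega), if_neg (by omega),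
      if_neg (by omega), if_neg (by omega)]
    rfl
  rw [hN] at t4
  rw [surfaceConfig_eq_of_even hL m 2 12 N (by norm_num) ?_ ?_ ?_ t3 t4 v h1 h2,
    surfaceConfig_eq_of_even hL m 1 2 M (by norm_num) ?_ ?_ ?_ t1 t2 v h1 h2]
  · rw [pow_one]
    omega
  · rw [pow_succ]
    omega
  · rw [pow_succ]
    nth_rewrite 2 [hM]
    rw [mul_left_comm]
    omega
  · rw [← hN, sq]
    exact Nat.mul_lt_mul_of_pos_left (by omega) hL
  · rw [pow_add]
    omega
  · rw [← hN, pow_add, sq]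
    nth_rewrite 3 [hM]
    rw [show len a b c d ^ m * (len a b c d * (2 * (M + 1))) =
      2 * (len a b c d ^ m * (len a b c d * (M + 1))) by ring]
    omega

theorem eventually_le_pow_div {q : ℕ} (hq : 2 ≤ q) (x : ℤ) :
    ∀ᶠ n : ℕ in atTop, x ≤ (q ^ n / 2 : ℕ) := by
  have h := tendsto_pow_atTop_atTop_of_one_lt (show 1 < q by omega)
  filter_upwards [h.eventually_ge_atTop (2 * x.toNat)] with n hn
  omega

theorem exists_tendsto_surfaceConfig (hd : 4 * (a + b + c) ≤ d) (ha : 0 < a) :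
    ∃ x, Tendsto (surfaceConfig a b c d) atTop (𝓝 x) := by
  have hlen : len a b c d = 2 * (a + b + c) + d := rfl
  have key : ∀ v, ∀ᶠ n in atTop, surfaceConfig a b c d (n + 1) v = surfaceConfig a b c d n v := by
    intro v
    have e1 := eventually_le_pow_div (show 2 ≤ 5 by norm_num) |v.1|
    have e2 := eventually_le_pow_div (show 2 ≤ len a b c d by omega) |v.2.1|
    rcases Nat.mod_two_eq_zero_or_one (len a b c d) with h | h
    · have e3 : ∀ᶠ m in atTop,
          surfaceConfig a b c d (m + 2) v = surfaceConfig a b c d (m + 1) v := by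
        filter_upwards [e1, e2] with m h1 h2
        refine surfaceConfig_succ_of_even hd ha h m v h1 (h2.trans_lt ?_)
        have : 0 < len a b c d ^ m := pow_pos (by omega) m
        omega
      obtain ⟨N, hN⟩ := eventually_atTop.1 e3
      refine eventually_atTop.2 ⟨N + 1, fun n hn => ?_⟩
      obtain ⟨m, rfl⟩ := Nat.exists_eq_add_of_le' (show 1 ≤ n by omega)
      exact hN m (by omega)
    · filter_upwards [e1, e2] with n h1 h2
      exact surfaceConfig_succ_of_odd h n v h1 h2
  have lim : ∀ v, ∃ y, ∀ᶠ n in atTop, surfaceConfig a b c d n v = y := by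
    intro v
    obtain ⟨N, hN⟩ := eventually_atTop.1 (key v)
    refine ⟨surfaceConfig a b c d N v, eventually_atTop.2 ⟨N, fun n hn => ?_⟩⟩
    induction n, hn using Nat.le_induction with
    | base => rfl
    | succ n hn ih => exact (hN n hn).trans ih
  choose x hx using lim
  exact ⟨x, tendsto_pi_nhds.2 fun v => tendsto_nhds_of_eventually_eq (hx v)⟩

theorem tendsto_surfaceConfig (hd : 4 * (a + b + c) ≤ d) (ha : 0 < a) :
    Tendsto (surfaceConfig a b c d) atTop (𝓝 (limitConfig a b c d)) :=
  tendsto_nhds_limUnder (exists_tendsto_surfaceConfig hd ha)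

/-! ## The limit configuration -/

theorem cubeOf_ne_zero (t : Tile) : cubeOf t ≠ 0 := by
  change cubeOf t ≠ Cube.blank
  unfold cubeOf
  split <;> simp

theorem surfaceConfig_ne_zero {n : ℕ} {v : ℤ × ℤ × ℤ} :
    surfaceConfig a b c d n v ≠ 0 ↔
      0 ≤ v.1 + (5 ^ n / 2 : ℕ) ∧ v.1 + (5 ^ n / 2 : ℕ) < 5 ^ n ∧
      0 ≤ v.2.1 + (len a b c d ^ n / 2 : ℕ) ∧
      v.2.1 + (len a b c d ^ n / 2 : ℕ) < (len a b c d : ℤ) ^ n ∧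
      v.2.2 = cubeHeight a b c d n flatTile (v.1 + (5 ^ n / 2 : ℕ)).toNat
        (v.2.1 + (len a b c d ^ n / 2 : ℕ)).toNat -
        cubeHeight a b c d n flatTile (5 ^ n / 2) (len a b c d ^ n / 2) := by
  simp only [surfaceConfig]
  split_ifs with h <;> simp only [h, cubeOf_ne_zero, ne_eq, not_true_eq_false, not_false_eq_true]
  simp

/-- A margin is required only to the south and north, for the neighbouring blocks; to the west and
east a block never leaves the macrotile. -/
theorem patchAt_surfaceConfig (hL : 0 < len a b c d) {m n : ℕ} {p : ℤ × ℤ × ℤ}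
    (hp : surfaceConfig a b c d (m + n) p ≠ 0)
    (h1 : (len a b c d ^ m : ℕ) ≤ p.2.1 + (len a b c d ^ (m + n) / 2 : ℕ))
    (h2 : p.2.1 + (len a b c d ^ (m + n) / 2 : ℕ) + (len a b c d ^ m : ℕ) <
      (len a b c d ^ (m + n) : ℕ)) :
    PatchAt a b c d m p (surfaceConfig a b c d (m + n)) := by
  have hl : 0 < len a b c d ^ m := pow_pos hL m
  obtain ⟨g1, g2, g3, g4, g5⟩ := surfaceConfig_ne_zero.1 hp
  obtain ⟨i, hi⟩ := Int.eq_ofNat_of_zero_le g1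
  obtain ⟨j, hj⟩ := Int.eq_ofNat_of_zero_le g3
  rw [hi, hj, Int.toNat_natCast, Int.toNat_natCast] at g5
  rw [hj] at h1 h2
  refine ⟨n, i, j, by exact_mod_cast h1, fun i' j' e1 e2 e3 => ?_⟩
  rw [surfaceConfig_ne_zero]
  simp only [patchCell]
  rw [show p.1 + i' - i + (5 ^ (m + n) / 2 : ℕ) = (i' : ℤ) by linarith,
    show p.2.1 + j' - j + (len a b c d ^ (m + n) / 2 : ℕ) = (j' : ℤ) by linarith, g5,
    Int.toNat_natCast, Int.toNat_natCast]
  refine ⟨by positivity, ?_, by positivity, ?_, by ring⟩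
  · rw [hi] at g2
    have g2' : i < 5 ^ (m + n) := by exact_mod_cast g2
    rw [pow_add] at g2'
    have := Nat.div_lt_of_lt_mul g2'
    rw [← e1, Nat.div_lt_iff_lt_mul (by positivity), mul_comm, ← pow_add] at this
    exact_mod_cast this
  · have h2' : j + len a b c d ^ m < len a b c d ^ m * len a b c d ^ n := by
      rw [← pow_add]
      exact_mod_cast h2
    have h3 := Nat.div_lt_of_lt_mul h2'
    rw [Nat.add_div_right _ hl] at h3
    have h4 : j' / len a b c d ^ m < len a b c d ^ n := by omega
    rw [Nat.div_lt_iff_lt_mul hl, mul_comm, ← pow_add] at h4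
    exact_mod_cast h4

/-- Two cells in one column already occur together in some `x^n`, which is the graph of a height
function. For the patches, every fixed cell is eventually far from the south and north borders, and
`isClosed_patchAt` passes to the limit. -/
theorem limitConfig_mem_patchwork (hd : 4 * (a + b + c) ≤ d) (ha : 0 < a) :
    limitConfig a b c d ∈ patchwork a b c d := by
  have hlen : len a b c d = 2 * (a + b + c) + d := rfl
  have hL : 0 < len a b c d := by omega
  have lim := tendsto_surfaceConfig hd ha
  have ev : ∀ p, ∀ᶠ n in atTop, surfaceConfig a b c d n p = limitConfig a b c d p := fun p =>
    lim.eventually (eventually_apply_eq _ p)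
  refine ⟨fun p q hpq h1 h2 => ?_, fun m p hp => ?_⟩
  · by_contra hne
    have n1 := ne_zero_of_reachable hpq hne
    have n2 := ne_zero_of_reachable hpq.symm (Ne.symm hne)
    obtain ⟨n, e1, e2⟩ := ((ev p).and (ev q)).exists
    rw [← e1, surfaceConfig_ne_zero] at n1
    rw [← e2, surfaceConfig_ne_zero] at n2
    have h3 : p.2.2 = q.2.2 := by
      rw [n1.2.2.2.2, n2.2.2.2.2, h1, h2]
    exact hne (Prod.ext h1 (Prod.ext h2 h3))
  · refine (isClosed_patchAt ha m p).mem_of_tendsto (lim.comp (tendsto_add_atTop_nat m)) ?_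
    have e1 := eventually_le_pow_div (show 2 ≤ len a b c d by omega)
      (|p.2.1| + (len a b c d ^ m : ℕ) + 1)
    have e2 := (ev p).and e1
    have e3 := (tendsto_add_atTop_nat m).eventually e2
    filter_upwards [e3] with n hn
    obtain ⟨h1, h2⟩ := hn
    have h3 := neg_abs_le p.2.1
    have h4 := le_abs_self p.2.1
    simp only [Function.comp_apply]
    rw [add_comm n m] at *
    refine patchAt_surfaceConfig hL (by rwa [h1]) (by linarith) ?_
    generalize len a b c d ^ (m + n) = q at *
    omega

theorem subshiftZ_subset_patchwork (hd : 4 * (a + b + c) ≤ d) (ha : 0 < a) :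
    subshiftZ a b c d ⊆ patchwork a b c d :=
  Set.sInter_subset_of_mem ⟨isZeroGluing_patchwork ha,
    orbitClosure_subset (isSubshift_patchwork ha) (limitConfig_mem_patchwork hd ha)⟩

end Convergence

end SparseSubshift

theorem mainTheorem7 (a b c d : ℕ) (ha : 0 < a)
    (hbc : ((b : ℝ) + c) / (2 * a - 1) + 1 + 6 * a < min ((b : ℝ) / 7) ((c : ℝ) / 8))
    (hd : 4 * (a + b + c) ≤ d) :
    Tendsto (SparseSubshift.surfaceConfig a b c d) atTop
        (𝓝 (SparseSubshift.limitConfig a b c d)) ∧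
      SparseSubshift.IsZeroGluing 1 (SparseSubshift.subshiftZ a b c d) ∧
      SparseSubshift.IsSparse 2
        (SparseSubshift.verticalTrace (SparseSubshift.subshiftZ a b c d)) := by
  refine ⟨SparseSubshift.tendsto_surfaceConfig hd ha,
    SparseSubshift.isZeroGluing_zeroGluingClosure _ _, ?_⟩
  rintro _ ⟨z, hz, rfl⟩
  exact SparseSubshift.isSparse_verticalTrace_patchwork ha hbc hd _
    ⟨z, SparseSubshift.subshiftZ_subset_patchwork hd ha hz, rfl⟩
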